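/- All tilings are edge-to-edge tilings of the unit sphere $S^2$ by finitely many spherical quadrangles. A spherical quadrangle is a closed region, possibly concave, bounded by a simple closed curve made of four minor great-circle arcs (its edges), none of whose inner angles is a straight angle. It is of type 2 if its edge lengths, in cyclic order, are $a,a,a,b$ with $a\neq b$, and of type 4 if they are $a,a,c,b$ with $a,b,c$ mutually distinct. Consider the following configuration in a tiling: vertices $N$, $S$ and $v_{-2},v_{-1},\dots,v_7$, such that - $N v_k v_{k+1} v_{k+2}$ is a tile for $k=-2,0,2,4$, and $S v_k v_{k+1} v_{k+2}$ is a tile for $k=-1,1,3,5$; - each of $v_{-1},v_0,\dots,v_6$ is 3-valent, $v_k$ being joined exactly to $v_{k-1}$, $v_{k+1}$ and $N$ (for $k$ even) or $S$ (for $k$ odd); - the twelve vertices are distinct, except that $(v_6,v_7)=(v_{-2},v_{-1})$ is allowed (this can happen only when there are $8$ tiles). Any number of further edges may occur at $N$, $S$, $v_{-2}$, $v_7$, outside the eight tiles listed. The orientation of the configuration is not prescribed, so each pattern below is meant together with its mirror image. **Theorem.** Suppose given a tiling of $S^2$ by $F$ congruent quadrangles (mirror-image copies being allowed), of type 2 with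 edge lengths $a,a,a,b$ or of type 4 with edge lengths $a,a,c,b$. If the tile is convex, or $F=6$, or $F=8$, then: 1. the tiling contains no configuration as above in which the edges of length $b$ are exactly $Nv_0$, $Sv_1$, $Nv_4$, $Sv_5$ among the displayed edges; 2. the tiling contains no configuration as above in which the edges of length $b$ are exactly $Nv_0$, $Sv_1$, $v_3v_4$, $v_5v_6$ among the displayed edges. -/

import Mathlib

/-- The unit sphere in Euclidean three-space. -/
abbrev Sph : Type := Metric.sphere (0 : EuclideanSpace ℝ (Fin 3)) 1

/-- A point of the sphere as a vector of the ambient space. -/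
abbrev Sph.vec (X : Sph) : EuclideanSpace ℝ (Fin 3) := X.1

/-- Spherical distance (the length of the minor arc joining the two points). -/
noncomputable def sdist (A B : Sph) : ℝ := InnerProductGeometry.angle A.vec B.vec

/-- The minor great-circle arc joining two non-antipodal points, end points included. -/
def arc (A B : Sph) : Set Sph :=
  {X | ∃ s t : ℝ, 0 ≤ s ∧ 0 ≤ t ∧ X.vec = s • A.vec + t • B.vec}

/-- `R` is a closed region of the sphere bounded by the simple closed spherical quadrangle with
successive vertices `q 0, q 1, q 2, q 3`; it may be concave. The edges are minor arcs. No three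
successive vertices lie on one great circle, i.e. every vertex is a genuine corner (the inner
angle is not a straight angle); this also makes successive vertices distinct and not antipodal,
and makes adjacent edges meet only in their common vertex. -/
structure IsQuadrangle (R : Set Sph) (q : Fin 4 → Sph) : Prop where
  corner : ∀ k, LinearIndependent ℝ ![(q k).vec, (q (k + 1)).vec, (q (k + 2)).vec]
  simple : ∀ k, Disjoint (arc (q k) (q (k + 1))) (arc (q (k + 2)) (q (k + 3)))
  frontier_eq : frontier R = ⋃ k, arc (q k) (q (k + 1))
  regular : closure (interior R) = R
  connected : IsConnected (interior R)

/-- A region of the sphere is convex when it contains, with any two of its points that are not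
antipodal, the minor arc joining them. -/
def IsSphConvex (R : Set Sph) : Prop :=
  ∀ X ∈ R, ∀ Y ∈ R, X.vec ≠ -Y.vec → arc X Y ⊆ R

/-- The quadrangle with vertices `q 0, q 1, q 2, q 3` is of type 2: three edges of length `a`, and
an edge of another length `b`. -/
def IsType2 (q : Fin 4 → Sph) (a b : ℝ) : Prop :=
  sdist (q 0) (q 1) = a ∧ sdist (q 1) (q 2) = a ∧ sdist (q 2) (q 3) = a ∧ sdist (q 3) (q 0) = b ∧
    a ≠ b

/-- The quadrangle with vertices `q 0, q 1, q 2, q 3` is of type 4: two adjacent edges of length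
`a`, and two further edges of lengths `c` and `b`, where `a`, `b`, `c` are mutually distinct. -/
def IsType4 (q : Fin 4 → Sph) (a b c : ℝ) : Prop :=
  sdist (q 0) (q 1) = a ∧ sdist (q 1) (q 2) = a ∧ sdist (q 2) (q 3) = c ∧ sdist (q 3) (q 0) = b ∧
    a ≠ b ∧ a ≠ c ∧ b ≠ c

/-- An edge-to-edge tiling of the sphere by `F` (possibly concave) spherical quadrangles. -/
structure SphericalTiling (F : ℕ) where
  /-- the tiles -/
  tile : Fin F → Set Sph
  /-- the vertices of each tile, in an order in which they follow each other on its boundary -/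
  vert : Fin F → Fin 4 → Sph
  isQuadrangle : ∀ j, IsQuadrangle (tile j) (vert j)
  cover : ⋃ j, tile j = Set.univ
  nonoverlapping : Pairwise fun i j => Disjoint (interior (tile i)) (interior (tile j))
  /-- two edges of tiles have the same end points, or meet at most in common end points -/
  edge_to_edge : ∀ i j m n,
    ({vert i m, vert i (m + 1)} : Set Sph) = {vert j n, vert j (n + 1)} ∨
      arc (vert i m) (vert i (m + 1)) ∩ arc (vert j n) (vert j (n + 1)) ⊆
        {vert i m, vert i (m + 1)} ∩ {vert j n, vert j (n + 1)}

namespace SphericalTiling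

variable {F : ℕ}

/-- Any two tiles are congruent by an orthogonal transformation (possibly reversing orientation)
that respects the numbering of the vertices. -/
def Congruent (T : SphericalTiling F) : Prop :=
  ∀ i j, ∃ g : EuclideanSpace ℝ (Fin 3) ≃ₗᵢ[ℝ] EuclideanSpace ℝ (Fin 3),
    (∀ k, g (T.vert i k).vec = (T.vert j k).vec) ∧
      g '' (Sph.vec '' T.tile i) = Sph.vec '' T.tile j

/-- `u` and `v` are joined by an edge of the tiling. -/
def Adj (T : SphericalTiling F) (u v : Sph) : Prop :=
  ∃ j k, (T.vert j k = u ∧ T.vert j (k + 1) = v) ∨ (T.vert j k = v ∧ T.vert j (k + 1) = u)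

/-- The vertices joined to `v` by an edge of the tiling. -/
def neighbors (T : SphericalTiling F) (v : Sph) : Set Sph := {u | T.Adj v u}

/-- Some tile has the vertices `u, v, w, x` in this order along its boundary, read in either of the
two directions and from any starting vertex. -/
def IsFace (T : SphericalTiling F) (u v w x : Sph) : Prop :=
  ∃ j k, (T.vert j k = u ∧ T.vert j (k + 1) = v ∧ T.vert j (k + 2) = w ∧ T.vert j (k + 3) = x) ∨
    (T.vert j k = x ∧ T.vert j (k + 1) = w ∧ T.vert j (k + 2) = v ∧ T.vert j (k + 3) = u)

/-- The configuration of vertices, edges and faces common to the two patterns: a path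
`v (-2), v (-1), ..., v 7`, whose vertices with even (odd) index are joined to `N` (to `S`), with
the eight quadrangular faces cut out in this way. Successive edges at `N` (at `S`) in the list
`v (-2), v 0, v 2, v 4, v 6` (in `v (-1), v 1, v 3, v 5, v 7`) are thus consecutive, while further
edges may lie between the last and the first one; `v (-1), ..., v 6` are 3-valent; further edges
may occur at `v (-2)` and `v 7`. The displayed vertices are distinct, except that the pair
`v 6, v 7` may be the pair `v (-2), v (-1)` (then the eight faces close up around `N` and `S`,
and are all the tiles). The orientation is not prescribed, so that a configuration and its mirror
image are covered alike. -/
structure IsWheelPart (T : SphericalTiling F) (N S : Sph) (v : ℤ → Sph) : Prop where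
  poles_ne : N ≠ S
  ne_pole : ∀ k ∈ Set.Icc (-2 : ℤ) 7, v k ≠ N ∧ v k ≠ S
  distinct : Set.InjOn v (Set.Icc (-2) 7) ∨
    (Set.InjOn v (Set.Icc (-2) 5) ∧ v 6 = v (-2) ∧ v 7 = v (-1))
  north_face : ∀ k ∈ ({-2, 0, 2, 4} : Set ℤ), T.IsFace N (v k) (v (k + 1)) (v (k + 2))
  south_face : ∀ k ∈ ({-1, 1, 3, 5} : Set ℤ), T.IsFace S (v k) (v (k + 1)) (v (k + 2))
  even_valence : ∀ k ∈ ({0, 2, 4, 6} : Set ℤ), T.neighbors (v k) = {v (k - 1), v (k + 1), N}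
  odd_valence : ∀ k ∈ ({-1, 1, 3, 5} : Set ℤ), T.neighbors (v k) = {v (k - 1), v (k + 1), S}

/-- The left pattern, or its mirror image: two pairs of consecutive meridian edges of length `b`.
(When every tile has exactly one edge of length `b`, the displayed edges other than the listed ones
have lengths different from `b`, since each displayed face contains a listed edge.) -/
structure LeftPattern (T : SphericalTiling F) (b : ℝ) (N S : Sph) (v : ℤ → Sph) : Prop where
  wheel : T.IsWheelPart N S v
  edge1 : sdist N (v 0) = b
  edge2 : sdist S (v 1) = b
  edge3 : sdist N (v 4) = b
  edge4 : sdist S (v 5) = b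

/-- The right pattern, or its mirror image: consecutive meridian edges of length `b`, followed by
two consecutive non-meridian edges of length `b`. (The other displayed edges again have lengths
different from `b` when every tile has exactly one edge of length `b`.) -/
structure RightPattern (T : SphericalTiling F) (b : ℝ) (N S : Sph) (v : ℤ → Sph) : Prop where
  wheel : T.IsWheelPart N S v
  edge1 : sdist N (v 0) = b
  edge2 : sdist S (v 1) = b
  edge3 : sdist (v 3) (v 4) = b
  edge4 : sdist (v 5) (v 6) = b

end SphericalTiling

open Real Set Filter Topology RealInnerProductSpace

/-! Every tile has exactly one edge of length `b`. Hence, once the `b`-edges of a pattern are known,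
each of its eight tiles is placed up to one binary choice: its angles, read from one end of the
`b`-edge to the other, are `α, β, γ, δ` or `δ, γ, β, α`. The theorem compares the resulting angle
sums around the vertices.

The topological definition of a quadrangle first has to yield angles. Near a vertex the region is
exactly one of the two sectors cut out by its two edges (`IsQuadrangle.hasCorner`). Sectors of
non-overlapping tiles that follow each other around a point add up to `2π` when they close up, and
to at most `2π` otherwise (`corner_sum_three`, `corner_sum_four`).

Spherical geometry contributes three facts. A quadrangle with two equal adjacent edges and equal
angles at their far ends is a kite (`IsQuadrangle.kite`), so `α ≠ γ`, and also `β ≠ δ` when `c = a`.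
No angle is straight. If the tile is convex and `c = a`, the laws of cosines for the two diagonals
give `β < γ ↔ δ < α` and its reverse (`Dims.order`).

For `a ≠ c` the edge lengths alone fix enough orientations: the left pattern forces `α = γ`, and the
right one asks one edge to have both lengths `a` and `c`. For `a = c` the equations are linear in
`α, β, γ, δ`, and all choices of orientation are refuted one by one. A convex tile brings bounds on
the angles and their ordering. The eight displayed tiles are distinct, so `F = 6` cannot occur,
while for `F = 8` the wheel closes up and supplies two more vertex equations and equalities at both
poles. -/

abbrev E3 : Type := EuclideanSpace ℝ (Fin 3)

/-! ### Orthonormal frames and polar coordinates on the sphere. -/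

theorem Sph.norm_vec (X : Sph) : ‖X.vec‖ = 1 := by
  simp

theorem Sph.inner_self (X : Sph) : ⟪X.vec, X.vec⟫ = 1 := by
  rw [real_inner_self_eq_norm_sq, X.norm_vec]; norm_num

theorem Sph.inner_eq_cos (X Y : Sph) : ⟪X.vec, Y.vec⟫ = cos (sdist X Y) := by
  rw [sdist, InnerProductGeometry.cos_angle, X.norm_vec, Y.norm_vec]; simp

theorem sdist_comm (X Y : Sph) : sdist X Y = sdist Y X :=
  InnerProductGeometry.angle_comm _ _

theorem frame_inner (e : OrthonormalBasis (Fin 3) ℝ E3) (i j : Fin 3) :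
    ⟪e i, e j⟫ = if i = j then 1 else 0 :=
  orthonormal_iff_ite.1 e.orthonormal i j

theorem frame_inner_comb (e : OrthonormalBasis (Fin 3) ℝ E3) (x y z x' y' z' : ℝ) :
    ⟪x • e 0 + y • e 1 + z • e 2, x' • e 0 + y' • e 1 + z' • e 2⟫ = x * x' + y * y' + z * z' := by
  simp [inner_add_left, inner_add_right, real_inner_smul_left, real_inner_smul_right]
  ring

theorem frame_expand (e : OrthonormalBasis (Fin 3) ℝ E3) (X : E3) :
    X = ⟪e 0, X⟫ • e 0 + ⟪e 1, X⟫ • e 1 + ⟪e 2, X⟫ • e 2 := by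
  conv_lhs => rw [← e.sum_repr' X]
  simp [Fin.sum_univ_three]

theorem frame_comb_inj (e : OrthonormalBasis (Fin 3) ℝ E3) {x y z x' y' z' : ℝ}
    (h : x • e 0 + y • e 1 + z • e 2 = x' • e 0 + y' • e 1 + z' • e 2) :
    x = x' ∧ y = y' ∧ z = z' := by
  have h0 := congrArg (fun v => ⟪(1:ℝ) • e 0 + (0:ℝ) • e 1 + (0:ℝ) • e 2, v⟫) h
  have h1 := congrArg (fun v => ⟪(0:ℝ) • e 0 + (1:ℝ) • e 1 + (0:ℝ) • e 2, v⟫) h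
  have h2 := congrArg (fun v => ⟪(0:ℝ) • e 0 + (0:ℝ) • e 1 + (1:ℝ) • e 2, v⟫) h
  simp only [frame_inner_comb] at h0 h1 h2
  exact ⟨by linarith, by linarith, by linarith⟩

theorem exists_frame {x y z : E3} (h : Orthonormal ℝ ![x, y, z]) :
    ∃ e : OrthonormalBasis (Fin 3) ℝ E3, e 0 = x ∧ e 1 = y ∧ e 2 = z := by
  have hc : Fintype.card (Fin 3) = Module.finrank ℝ E3 := by simp
  let b := basisOfOrthonormalOfCardEqFinrank h hc
  have hb : ⇑b = ![x, y, z] := coe_basisOfOrthonormalOfCardEqFinrank h hc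
  refine ⟨b.toOrthonormalBasis (hb ▸ h), ?_, ?_, ?_⟩ <;> simp [hb]

/-- A frame adapted to a given one: the second and third vector turned by `ω`. -/
theorem exists_turned_frame (e : OrthonormalBasis (Fin 3) ℝ E3) (ω : ℝ) :
    ∃ e' : OrthonormalBasis (Fin 3) ℝ E3, e' 0 = e 0 ∧ e' 1 = cos ω • e 1 + sin ω • e 2 ∧
      e' 2 = -sin ω • e 1 + cos ω • e 2 := by
  have h : Orthonormal ℝ ![(1 : ℝ) • e 0 + (0 : ℝ) • e 1 + (0 : ℝ) • e 2,
      (0 : ℝ) • e 0 + cos ω • e 1 + sin ω • e 2, (0 : ℝ) • e 0 + (-sin ω) • e 1 + cos ω • e 2] := by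
    have cs := sin_sq_add_cos_sq ω
    rw [orthonormal_iff_ite]
    intro i j
    fin_cases i <;> fin_cases j <;> dsimp <;> rw [frame_inner_comb] <;> norm_num <;>
      first | ring1 | linear_combination cs
  simpa using exists_frame h

theorem exists_flipped_frame (e : OrthonormalBasis (Fin 3) ℝ E3) :
    ∃ e' : OrthonormalBasis (Fin 3) ℝ E3, e' 0 = e 0 ∧ e' 1 = e 1 ∧ e' 2 = -e 2 := by
  apply exists_frame
  rw [orthonormal_iff_ite]
  intro i j
  fin_cases i <;> fin_cases j <;> simp

/-- Frames are not required to be positively oriented. The third vector is a unit vector orthogonal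
to the other two, and the remaining sign is the orientation. -/
theorem frame_third_eq_or_neg (e e' : OrthonormalBasis (Fin 3) ℝ E3) {ω : ℝ} (h0 : e' 0 = e 0)
    (h1 : e' 1 = cos ω • e 1 + sin ω • e 2) :
    e' 2 = -sin ω • e 1 + cos ω • e 2 ∨ e' 2 = -(-sin ω • e 1 + cos ω • e 2) := by
  have hx := frame_expand e (e' 2)
  have a0 : ⟪e 0, e' 2⟫ = 0 := by rw [← h0, frame_inner]; simp
  have a1 : cos ω * ⟪e 1, e' 2⟫ + sin ω * ⟪e 2, e' 2⟫ = 0 := by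
    have : ⟪e' 1, e' 2⟫ = 0 := by rw [frame_inner]; simp
    rw [h1] at this
    simpa [inner_add_left, real_inner_smul_left] using this
  have a2 : ⟪e 1, e' 2⟫ ^ 2 + ⟪e 2, e' 2⟫ ^ 2 = 1 := by
    have : ⟪e' 2, e' 2⟫ = 1 := by rw [frame_inner]; simp
    rw [hx, frame_inner_comb, a0] at this
    linarith
  set y := ⟪e 1, e' 2⟫
  set z := ⟪e 2, e' 2⟫
  have cs := sin_sq_add_cos_sq ω
  have hz : (z - cos ω) * (z + cos ω) = 0 := by
    have : (cos ω * y) ^ 2 = (sin ω * z) ^ 2 := by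
      rw [show cos ω * y = - (sin ω * z) by linarith]; ring
    nlinarith
  have hk : y * cos ω = - (sin ω * z) := by linarith
  by_cases hc : cos ω = 0
  · have hs : sin ω ^ 2 = 1 := by rw [hc] at cs; linarith
    have hz0 : z = 0 := by
      rw [hc] at hz; nlinarith
    have hy : (y + sin ω) * (y - sin ω) = 0 := by rw [hz0] at a2; nlinarith
    rcases mul_eq_zero.1 hy with h | h
    · left; rw [hx, a0, hz0, hc, show y = - sin ω by linarith]; simp
    · right; rw [hx, a0, hz0, hc, show y = sin ω by linarith]; simp
  · rcases mul_eq_zero.1 hz with h | h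
    · left
      have hz : z = cos ω := by linarith
      have : y = - sin ω := by
        apply mul_right_cancel₀ hc; rw [hk, hz]; ring
      rw [hx, a0, hz, this]; simp
    · right
      have hz : z = - cos ω := by linarith
      have : y = sin ω := by
        apply mul_right_cancel₀ hc; rw [hk, hz]; ring
      rw [hx, a0, hz, this]; module

/-- The point at distance `t` from `e 0` in the direction `cos φ • e 1 + sin φ • e 2`. -/
noncomputable def polar (e : OrthonormalBasis (Fin 3) ℝ E3) (t φ : ℝ) : Sph :=
  ⟨cos t • e 0 + (sin t * cos φ) • e 1 + (sin t * sin φ) • e 2, by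
    rw [mem_sphere_zero_iff_norm]
    have h : ‖cos t • e 0 + (sin t * cos φ) • e 1 + (sin t * sin φ) • e 2‖ ^ 2 = 1 := by
      rw [← real_inner_self_eq_norm_sq, frame_inner_comb]
      have := sin_sq_add_cos_sq t
      have := sin_sq_add_cos_sq φ
      linear_combination (sin t) ^ 2 * this + sin_sq_add_cos_sq t
    nlinarith [norm_nonneg (cos t • e 0 + (sin t * cos φ) • e 1 + (sin t * sin φ) • e 2)]⟩

theorem polar_vec (e : OrthonormalBasis (Fin 3) ℝ E3) (t φ : ℝ) : (polar e t φ).vec =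
    cos t • e 0 + (sin t * cos φ) • e 1 + (sin t * sin φ) • e 2 := rfl

theorem polar_inner_zero (e : OrthonormalBasis (Fin 3) ℝ E3) (t φ : ℝ) :
    ⟪e 0, (polar e t φ).vec⟫ = cos t := by
  simp [polar_vec, inner_add_right, real_inner_smul_right]

theorem polar_inner_one (e : OrthonormalBasis (Fin 3) ℝ E3) (t φ : ℝ) :
    ⟪e 1, (polar e t φ).vec⟫ = sin t * cos φ := by
  simp [polar_vec, inner_add_right, real_inner_smul_right]

theorem polar_inner_two (e : OrthonormalBasis (Fin 3) ℝ E3) (t φ : ℝ) :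
    ⟪e 2, (polar e t φ).vec⟫ = sin t * sin φ := by
  simp [polar_vec, inner_add_right, real_inner_smul_right]

theorem continuous_polar (e : OrthonormalBasis (Fin 3) ℝ E3) :
    Continuous fun x : ℝ × ℝ => polar e x.1 x.2 := by
  unfold polar
  fun_prop

theorem polar_add_two_pi (e : OrthonormalBasis (Fin 3) ℝ E3) (t φ : ℝ) :
    polar e t (φ + 2 * π) = polar e t φ := by
  apply Subtype.ext; simp [polar]

theorem polar_sub_two_pi (e : OrthonormalBasis (Fin 3) ℝ E3) (t φ : ℝ) :
    polar e t (φ - 2 * π) = polar e t φ := by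
  apply Subtype.ext; simp [polar]

theorem polar_turned {e e' : OrthonormalBasis (Fin 3) ℝ E3} {ω : ℝ} (h0 : e' 0 = e 0)
    (h1 : e' 1 = cos ω • e 1 + sin ω • e 2) (h2 : e' 2 = -sin ω • e 1 + cos ω • e 2) (t φ : ℝ) :
    polar e' t φ = polar e t (ω + φ) := by
  apply Subtype.ext
  simp only [polar, h0, h1, h2, cos_add, sin_add]
  module

theorem polar_turned_flipped {e e' : OrthonormalBasis (Fin 3) ℝ E3} {ω : ℝ} (h0 : e' 0 = e 0)
    (h1 : e' 1 = cos ω • e 1 + sin ω • e 2) (h2 : e' 2 = -(-sin ω • e 1 + cos ω • e 2))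
    (t φ : ℝ) : polar e' t φ = polar e t (ω - φ) := by
  apply Subtype.ext
  simp only [polar, h0, h1, h2, cos_sub, sin_sub]
  module

theorem polar_flipped {e e' : OrthonormalBasis (Fin 3) ℝ E3} (h0 : e' 0 = e 0)
    (h1 : e' 1 = e 1) (h2 : e' 2 = -e 2) (t φ : ℝ) : polar e' t φ = polar e t (-φ) := by
  apply Subtype.ext
  simp only [polar, h0, h1, h2, cos_neg, sin_neg]
  module

/-- Polar coordinates of a point. -/
theorem polar_arccos_arg (e : OrthonormalBasis (Fin 3) ℝ E3) (X : Sph) :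
    X = polar e (arccos ⟪e 0, X.vec⟫) (Complex.arg ⟨⟪e 1, X.vec⟫, ⟪e 2, X.vec⟫⟩) := by
  have hx := frame_expand e X.vec
  have hn := X.inner_self
  rw [hx, frame_inner_comb] at hn
  apply Subtype.ext
  change X.vec = cos _ • e 0 + (sin _ * cos _) • e 1 + (sin _ * sin _) • e 2
  set x := ⟪e 0, X.vec⟫
  set y := ⟪e 1, X.vec⟫
  set z := ⟪e 2, X.vec⟫
  have hc : cos (arccos x) = x := cos_arccos (by nlinarith) (by nlinarith)
  have hs : sin (arccos x) = ‖(⟨y, z⟩ : ℂ)‖ := by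
    rw [sin_arccos, Complex.norm_def, Complex.normSq_apply]
    congr 1
    simp only
    linarith
  have h1 : ‖(⟨y, z⟩ : ℂ)‖ * cos (Complex.arg ⟨y, z⟩) = y := Complex.norm_mul_cos_arg _
  have h2 : ‖(⟨y, z⟩ : ℂ)‖ * sin (Complex.arg ⟨y, z⟩) = z := Complex.norm_mul_sin_arg _
  rw [hc, hs, h1, h2, ← hx]

theorem angle_eq_of_cos_sin {φ ψ : ℝ} (hφ : 0 ≤ φ) (hφ' : φ < 2 * π) (hψ : 0 ≤ ψ)
    (hψ' : ψ < 2 * π) (hc : cos φ = cos ψ) (hs : sin φ = sin ψ) : φ = ψ := by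
  have h : cos (φ - ψ) = 1 := by rw [cos_sub, hc, hs]; nlinarith [sin_sq_add_cos_sq ψ]
  have := (cos_eq_one_iff_of_lt_of_lt (by linarith) (by linarith)).1 h
  linarith

/-- Two points in polar coordinates away from the pole coincide only for equal directions. -/
theorem direction_eq_of_polar_eq (e : OrthonormalBasis (Fin 3) ℝ E3) {s t φ ψ : ℝ} (hs : 0 < s)
    (hs' : s < π) (ht : 0 < t) (ht' : t < π) (h : polar e s φ = polar e t ψ) :
    s = t ∧ cos φ = cos ψ ∧ sin φ = sin ψ := by
  have h' := congrArg Sph.vec h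
  rw [polar_vec, polar_vec] at h'
  obtain ⟨h0, h1, h2⟩ := frame_comb_inj e h'
  have hst : s = t := injOn_cos ⟨hs.le, hs'.le⟩ ⟨ht.le, ht'.le⟩ h0
  subst hst
  have := (sin_pos_of_pos_of_lt_pi hs hs').ne'
  exact ⟨rfl, mul_left_cancel₀ this h1, mul_left_cancel₀ this h2⟩

/-- A preconnected set that avoids the frontier of `R` lies inside or outside of `R`. -/
theorem IsPreconnected.subset_interior_or_subset_compl {X : Type*} [TopologicalSpace X]
    {S R : Set X} (hS : IsPreconnected S) (h : Disjoint S (frontier R)) :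
    S ⊆ interior R ∨ S ⊆ (closure R)ᶜ := by
  have := isPreconnected_iff_subset_of_disjoint.1 hS (interior R) (closure R)ᶜ isOpen_interior
    isClosed_closure.isOpen_compl
  apply this
  · intro x hx
    by_cases h1 : x ∈ closure R
    · left
      by_contra h2
      exact Set.disjoint_left.1 h hx ⟨h1, h2⟩
    · exact Or.inr h1
  · ext x
    simp only [mem_inter_iff, mem_compl_iff, mem_empty_iff_false, iff_false, not_and, not_not]
    exact fun _ hx => subset_closure (interior_subset hx)

theorem sdist_eq_arccos (X Y : Sph) : sdist X Y = arccos ⟪X.vec, Y.vec⟫ := by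
  rw [sdist, InnerProductGeometry.angle, X.norm_vec, Y.norm_vec]; simp

/-- A chord is no longer than its arc: its square is `2 - 2 cos t ≤ t ^ 2`. -/
theorem dist_polar_le (e : OrthonormalBasis (Fin 3) ℝ E3) {p : Sph} (h : e 0 = p.vec) {t : ℝ}
    (ht : 0 ≤ t) (φ : ℝ) : dist (polar e t φ) p ≤ t := by
  rw [Subtype.dist_eq, dist_eq_norm]
  apply abs_le_of_sq_le_sq' _ ht |>.2
  rw [← real_inner_self_eq_norm_sq, inner_sub_left, inner_sub_right, inner_sub_right,
    (polar e t φ).inner_self, p.inner_self]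
  have h1 : ⟪p.vec, (polar e t φ).vec⟫ = cos t := by rw [← h, polar_inner_zero]
  have h2 : ⟪(polar e t φ).vec, p.vec⟫ = cos t := by rw [real_inner_comm, h1]
  rw [h1, h2]
  have := one_sub_sq_div_two_le_cos (x := t)
  linarith

theorem LinearIndependent.eq_zero_of_comb {x y z : E3} (h : LinearIndependent ℝ ![x, y, z])
    {a b c : ℝ} (h0 : a • x + b • y + c • z = 0) : a = 0 ∧ b = 0 ∧ c = 0 := by
  have := Fintype.linearIndependent_iff.1 h ![a, b, c] (by simpa [Fin.sum_univ_three] using h0)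
  exact ⟨this 0, this 1, this 2⟩

theorem exists_frame_of_pair {x y : E3} (h : Orthonormal ℝ ![x, y]) :
    ∃ e : OrthonormalBasis (Fin 3) ℝ E3, e 0 = x ∧ e 1 = y := by
  have hc : Module.finrank ℝ E3 = Fintype.card (Fin 3) := by simp
  have hv : Orthonormal ℝ (({0, 1} : Set (Fin 3)).domRestrict ![x, y, 0]) := by
    rw [orthonormal_iff_ite] at h ⊢
    rintro ⟨i, hi⟩ ⟨j, hj⟩
    have h00 : ⟪x, x⟫ = 1 := h 0 0
    have h01 : ⟪x, y⟫ = 0 := h 0 1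
    have h10 : ⟪y, x⟫ = 0 := h 1 0
    have h11 : ⟪y, y⟫ = 1 := h 1 1
    rcases hi with rfl | rfl <;> rcases hj with rfl | rfl
    · exact h00
    · exact h01
    · exact h10
    · exact h11
  obtain ⟨b, hb⟩ := hv.exists_orthonormalBasis_extension_of_card_eq hc
  exact ⟨b, hb 0 (by simp), hb 1 (by simp)⟩

/-- A frame at `p` whose second vector points towards `u`. -/
theorem exists_frame_towards {p u : Sph} (h : LinearIndependent ℝ ![p.vec, u.vec]) :
    ∃ e : OrthonormalBasis (Fin 3) ℝ E3, e 0 = p.vec ∧ u = polar e (sdist p u) 0 := by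
  set d : E3 := u.vec - ⟪p.vec, u.vec⟫ • p.vec with hd
  have hd0 : d ≠ 0 := by
    intro h0
    rw [LinearIndependent.pair_iff] at h
    have := h (-⟪p.vec, u.vec⟫) 1 (by rw [← h0, hd]; module)
    exact one_ne_zero this.2
  have hdn : ‖d‖ ≠ 0 := norm_ne_zero_iff.2 hd0
  have hpd : ⟪p.vec, d⟫ = 0 := by
    rw [hd, inner_sub_right, real_inner_smul_right, p.inner_self]; ring
  have ho : Orthonormal ℝ ![p.vec, ‖d‖⁻¹ • d] := by
    rw [orthonormal_iff_ite]
    intro i j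
    have hdd : ⟪d, d⟫ = ‖d‖ ^ 2 := real_inner_self_eq_norm_sq d
    fin_cases i <;> fin_cases j <;> dsimp <;>
      simp only [real_inner_smul_left, real_inner_smul_right, p.inner_self, hpd,
        real_inner_comm p.vec d, hdd] <;> norm_num
    field_simp
  obtain ⟨e, he0, he1⟩ := exists_frame_of_pair ho
  refine ⟨e, he0, ?_⟩
  have hu : u.vec = ⟪p.vec, u.vec⟫ • e 0 + ‖d‖ • e 1 := by
    rw [he0, he1, smul_smul, mul_inv_cancel₀ hdn, one_smul, hd]; abel
  have h1 : ⟪e 1, u.vec⟫ = ‖d‖ := by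
    rw [hu]; simp [inner_add_right, real_inner_smul_right]
  have h2 : ⟪e 2, u.vec⟫ = 0 := by
    rw [hu]; simp [inner_add_right, real_inner_smul_right]
  conv_lhs => rw [polar_arccos_arg e u, h1, h2]
  rw [sdist_eq_arccos, he0]
  congr 1
  exact Complex.arg_ofReal_of_nonneg (norm_nonneg d)

theorem exists_direction (e : OrthonormalBasis (Fin 3) ℝ E3) {p : Sph} (h : e 0 = p.vec)
    (w : Sph) : ∃ θ, 0 ≤ θ ∧ θ < 2 * π ∧ w = polar e (sdist p w) θ := by
  have hw := polar_arccos_arg e w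
  rw [h, ← sdist_eq_arccos] at hw
  set φ := Complex.arg ⟨⟪e 1, w.vec⟫, ⟪e 2, w.vec⟫⟩
  have h1 : -π < φ := Complex.neg_pi_lt_arg _
  have h2 : φ ≤ π := Complex.arg_le_pi _
  rcases le_or_gt 0 φ with h0 | h0
  · exact ⟨φ, h0, by linarith [pi_pos], hw⟩
  · exact ⟨φ + 2 * π, by linarith, by linarith, by rw [polar_add_two_pi]; exact hw⟩

theorem sdist_pos_and_lt {p u : Sph} (h : LinearIndependent ℝ ![p.vec, u.vec]) :
    0 < sdist p u ∧ sdist p u < π := by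
  obtain ⟨e, he, hu⟩ := exists_frame_towards h
  rw [LinearIndependent.pair_iff] at h
  have hs : sin (sdist p u) ≠ 0 := by
    intro h0
    have : u.vec = cos (sdist p u) • p.vec := by
      conv_lhs => rw [hu]
      rw [polar_vec, h0, he]; simp
    have := h (- cos (sdist p u)) 1 (by rw [this]; module)
    exact one_ne_zero this.2
  constructor
  · refine lt_of_le_of_ne (InnerProductGeometry.angle_nonneg _ _) fun h0 => hs ?_
    rw [← h0, sin_zero]
  · refine lt_of_le_of_ne (InnerProductGeometry.angle_le_pi _ _) fun h0 => hs ?_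
    rw [h0, sin_pi]

/-! ### Minor arcs. -/

theorem arc_comm (A B : Sph) : arc A B = arc B A := by
  ext X
  constructor <;> rintro ⟨s, t, hs, ht, h⟩ <;> exact ⟨t, s, ht, hs, by rw [h, add_comm]⟩

theorem left_mem_arc (A B : Sph) : A ∈ arc A B := ⟨1, 0, by simp, le_rfl, by simp⟩

theorem right_mem_arc (A B : Sph) : B ∈ arc A B := ⟨0, 1, le_rfl, by simp, by simp⟩

/-- The coefficients of a point with respect to `A` and `B` are continuous functions of it, obtained
by inverting the Gram matrix, whose determinant `1 - c ^ 2` is nonzero. The arc is then given by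
closed conditions on them. -/
theorem isClosed_arc {A B : Sph} (h : LinearIndependent ℝ ![A.vec, B.vec]) :
    IsClosed (arc A B) := by
  have hc : 1 - ⟪A.vec, B.vec⟫ ^ 2 ≠ 0 := by
    rw [Sph.inner_eq_cos, ← sin_sq]
    have := sdist_pos_and_lt h
    exact pow_ne_zero _ (sin_pos_of_pos_of_lt_pi this.1 this.2).ne'
  set c := ⟪A.vec, B.vec⟫ with hcdef
  let s : Sph → ℝ := fun X => (⟪X.vec, A.vec⟫ - c * ⟪X.vec, B.vec⟫) / (1 - c ^ 2)
  let t : Sph → ℝ := fun X => (⟪X.vec, B.vec⟫ - c * ⟪X.vec, A.vec⟫) / (1 - c ^ 2)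
  have hs : Continuous s := by fun_prop
  have ht : Continuous t := by fun_prop
  have : arc A B = {X | 0 ≤ s X} ∩ {X | 0 ≤ t X} ∩ {X | X.vec = s X • A.vec + t X • B.vec} := by
    ext X
    constructor
    · rintro ⟨s', t', hs', ht', h⟩
      have hA : ⟪X.vec, A.vec⟫ = s' + t' * c := by
        rw [h, inner_add_left, real_inner_smul_left, real_inner_smul_left, A.inner_self,
          real_inner_comm, ← hcdef]; ring
      have hB : ⟪X.vec, B.vec⟫ = s' * c + t' := by
        rw [h, inner_add_left, real_inner_smul_left, real_inner_smul_left, B.inner_self]; ring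
      have h1 : s X = s' := by
        simp only [s, hA, hB]; field_simp; ring
      have h2 : t X = t' := by
        simp only [t, hA, hB]; field_simp; ring
      simp only [mem_inter_iff, mem_ofPred_eq, h1, h2]
      exact ⟨⟨hs', ht'⟩, h⟩
    · rintro ⟨⟨h1, h2⟩, h3⟩
      exact ⟨s X, t X, h1, h2, h3⟩
  rw [this]
  refine ((isClosed_le continuous_const hs).inter (isClosed_le continuous_const ht)).inter
    (isClosed_eq continuous_subtype_val ?_)
  exact (hs.smul continuous_const).add (ht.smul continuous_const)

/-- Orthogonally to `p`, a point of the arc is a nonnegative multiple of `Y`. Comparing lengths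
gives `sin t = k * sin s`, where `0 ≤ k` excludes the opposite direction. -/
theorem direction_of_polar_mem_arc (e : OrthonormalBasis (Fin 3) ℝ E3) {p Y : Sph}
    (hp : e 0 = p.vec) {s ψ t φ : ℝ} (hY : Y = polar e s ψ) (hs : 0 < s) (hs' : s < π)
    (ht : 0 < t) (ht' : t < π) (h : polar e t φ ∈ arc p Y) : cos φ = cos ψ ∧ sin φ = sin ψ := by
  obtain ⟨c, k, -, hk, h⟩ := h
  have h' : cos t • e 0 + (sin t * cos φ) • e 1 + (sin t * sin φ) • e 2 =
      (c + k * cos s) • e 0 + (k * (sin s * cos ψ)) • e 1 + (k * (sin s * sin ψ)) • e 2 := by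
    rw [← polar_vec, h, hY, polar_vec, ← hp]; module
  obtain ⟨-, h1, h2⟩ := frame_comb_inj e h'
  have hst := sin_pos_of_pos_of_lt_pi ht ht'
  have hss := sin_pos_of_pos_of_lt_pi hs hs'
  have hks : sin t = k * sin s := by
    have h3 : sin t ^ 2 = (k * sin s) ^ 2 := by
      linear_combination (sin t * cos φ + k * (sin s * cos ψ)) * h1 +
        (sin t * sin φ + k * (sin s * sin ψ)) * h2 - sin t ^ 2 * sin_sq_add_cos_sq φ +
        k ^ 2 * sin s ^ 2 * sin_sq_add_cos_sq ψ
    exact (pow_left_inj₀ hst.le (by positivity) two_ne_zero).1 h3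
  constructor
  · apply mul_left_cancel₀ hst.ne'
    rw [h1, hks]; ring
  · apply mul_left_cancel₀ hst.ne'
    rw [h2, hks]; ring

theorem polar_mem_arc (e : OrthonormalBasis (Fin 3) ℝ E3) {p Y : Sph} (hp : e 0 = p.vec)
    {s ψ t : ℝ} (hY : Y = polar e s ψ) (hs : 0 < s) (hs' : s < π) (ht : 0 ≤ t) (ht' : t ≤ s) :
    polar e t ψ ∈ arc p Y := by
  have hss := sin_pos_of_pos_of_lt_pi hs hs'
  -- The coefficients of spherical linear interpolation.
  refine ⟨sin (s - t) / sin s, sin t / sin s, ?_, ?_, ?_⟩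
  · exact div_nonneg (sin_nonneg_of_nonneg_of_le_pi (by linarith) (by linarith)) hss.le
  · exact div_nonneg (sin_nonneg_of_nonneg_of_le_pi (by linarith) (by linarith)) hss.le
  · rw [hY, polar_vec, polar_vec, ← hp]
    have : cos t = sin (s - t) / sin s + sin t / sin s * cos s := by
      rw [sin_sub]; field_simp; ring
    rw [this]
    have h1 : sin t = sin t / sin s * sin s := by field_simp
    conv_lhs => rw [show sin t * cos ψ = sin t / sin s * (sin s * cos ψ) by field_simp,
      show sin t * sin ψ = sin t / sin s * (sin s * sin ψ) by field_simp]
    module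

/-! ### Corners of a quadrangle and their angles. -/

/-- The region `R` fills near `p` exactly the sector of angle `θ` between the arcs `p u` and
`p w`; the sector is described in polar coordinates of the frame `e`. -/
structure CornerFrame (R : Set Sph) (p u w : Sph) (θ : ℝ) (e : OrthonormalBasis (Fin 3) ℝ E3) :
    Prop where
  base : e 0 = p.vec
  dist_left : 0 < sdist p u ∧ sdist p u < π
  dist_right : 0 < sdist p w ∧ sdist p w < π
  left : u = polar e (sdist p u) 0
  right : w = polar e (sdist p w) θ
  pos : 0 < θ
  lt : θ < 2 * π
  sector : ∃ ε > 0, ∀ t, 0 < t → t < ε → (∀ φ, 0 < φ → φ < θ → polar e t φ ∈ interior R) ∧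
    ∀ φ, θ < φ → φ < 2 * π → polar e t φ ∉ R

/-- The region `R` has a corner of angle `θ` at `p` between the arcs `p u` and `p w`. -/
def HasCorner (R : Set Sph) (p u w : Sph) (θ : ℝ) : Prop := ∃ e, CornerFrame R p u w θ e

/-- Turning the frame by `θ` and then flipping it sweeps the same sector from its other arc. The
explicit vectors are needed to compare the two frames at a vertex in `IsQuadrangle.kite`. -/
theorem CornerFrame.exists_symm {R : Set Sph} {p u w : Sph} {θ : ℝ}
    {e : OrthonormalBasis (Fin 3) ℝ E3} (h : CornerFrame R p u w θ e) :
    ∃ e' : OrthonormalBasis (Fin 3) ℝ E3, e' 1 = cos θ • e 1 + sin θ • e 2 ∧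
      e' 2 = sin θ • e 1 - cos θ • e 2 ∧ CornerFrame R p w u θ e' := by
  obtain ⟨f, f0, f1, f2⟩ := exists_turned_frame e θ
  obtain ⟨e', h0, h1, h2⟩ := exists_flipped_frame f
  rw [f0] at h0
  rw [f1] at h1
  rw [f2] at h2
  have hpol := polar_turned_flipped h0 h1 h2
  obtain ⟨ε, hε, hsec⟩ := h.sector
  refine ⟨e', h1, by rw [h2]; module, h0.trans h.base, h.dist_right, h.dist_left, ?_, ?_, h.pos,
    h.lt, ε, hε, ?_⟩
  · rw [hpol, sub_zero]; exact h.right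
  · rw [hpol, sub_self]; exact h.left
  · intro t ht ht'
    constructor
    · intro φ hφ hφ'
      rw [hpol]
      exact (hsec t ht ht').1 _ (by linarith) (by linarith)
    · intro φ hφ hφ'
      rw [hpol, ← polar_add_two_pi]
      exact (hsec t ht ht').2 _ (by linarith) (by linarith)

theorem HasCorner.symm {R : Set Sph} {p u w : Sph} {θ : ℝ} (h : HasCorner R p u w θ) :
    HasCorner R p w u θ := by
  obtain ⟨e, h⟩ := h
  obtain ⟨e', -, -, h'⟩ := h.exists_symm
  exact ⟨e', h'⟩

theorem IsQuadrangle.rotate {R : Set Sph} {q : Fin 4 → Sph} (h : IsQuadrangle R q) (m : Fin 4) :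
    IsQuadrangle R fun i => q (i + m) where
  corner k := by
    simpa [add_right_comm] using h.corner (k + m)
  simple k := by
    simpa [add_right_comm] using h.simple (k + m)
  frontier_eq := by
    rw [h.frontier_eq, ← (Equiv.addRight m).surjective.iUnion_comp]
    simp [add_right_comm]
  regular := h.regular
  connected := h.connected

theorem IsQuadrangle.isClosed {R : Set Sph} {q : Fin 4 → Sph} (h : IsQuadrangle R q) :
    IsClosed R := by
  rw [← h.regular]; exact isClosed_closure

theorem IsQuadrangle.linearIndependent_edge {R : Set Sph} {q : Fin 4 → Sph}
    (h : IsQuadrangle R q) (k : Fin 4) :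
    LinearIndependent ℝ ![(q k).vec, (q (k + 1)).vec] := by
  rw [LinearIndependent.pair_iff]
  intro s t hst
  have := (h.corner k).eq_zero_of_comb (a := s) (b := t) (c := 0) (by simpa using hst)
  exact ⟨this.1, this.2.1⟩

theorem IsQuadrangle.frontier_eq_union {R : Set Sph} {q : Fin 4 → Sph} (h : IsQuadrangle R q) :
    frontier R = arc (q 0) (q 1) ∪ arc (q 1) (q 2) ∪ (arc (q 2) (q 3) ∪ arc (q 3) (q 0)) := by
  rw [h.frontier_eq]
  ext X
  rw [mem_iUnion]
  constructor
  · rintro ⟨k, hk⟩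
    fin_cases k
    · exact Or.inl (Or.inl hk)
    · exact Or.inl (Or.inr hk)
    · exact Or.inr (Or.inl hk)
    · exact Or.inr (Or.inr hk)
  · rintro ((h | h) | (h | h))
    · exact ⟨0, h⟩
    · exact ⟨1, h⟩
    · exact ⟨2, h⟩
    · exact ⟨3, h⟩

/-- The two edges that do not meet `q 1` form a closed set missing it, so a small ball around `q 1`
meets only the two edges issuing from it, each of which has a single direction. -/
theorem IsQuadrangle.exists_frontier_direction {R : Set Sph} {q : Fin 4 → Sph}
    (h : IsQuadrangle R q) {e : OrthonormalBasis (Fin 3) ℝ E3} (he : e 0 = (q 1).vec) {θ : ℝ}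
    (h2 : q 2 = polar e (sdist (q 1) (q 2)) 0) (h0 : q 0 = polar e (sdist (q 1) (q 0)) θ)
    (hs2 : 0 < sdist (q 1) (q 2) ∧ sdist (q 1) (q 2) < π)
    (hs0 : 0 < sdist (q 1) (q 0) ∧ sdist (q 1) (q 0) < π) :
    ∃ ε > 0, ε ≤ sdist (q 1) (q 2) ∧ ε ≤ sdist (q 1) (q 0) ∧ ∀ t φ, 0 < t → t < ε →
      polar e t φ ∈ frontier R → (cos φ = 1 ∧ sin φ = 0) ∨ (cos φ = cos θ ∧ sin φ = sin θ) := by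
  have hK : IsClosed (arc (q 2) (q 3) ∪ arc (q 3) (q 0)) :=
    (isClosed_arc (h.linearIndependent_edge 2)).union (isClosed_arc (h.linearIndependent_edge 3))
  have hpK : q 1 ∉ arc (q 2) (q 3) ∪ arc (q 3) (q 0) := by
    rintro (h' | h')
    · exact Set.disjoint_left.1 (h.simple 0) (right_mem_arc _ _) h'
    · exact Set.disjoint_left.1 (h.simple 1) (left_mem_arc _ _) h'
  obtain ⟨r, hr, hball⟩ := Metric.isOpen_iff.1 hK.isOpen_compl _ hpK
  refine ⟨min r (min (sdist (q 1) (q 2)) (sdist (q 1) (q 0))), ?_, ?_, ?_, ?_⟩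
  · exact lt_min hr (lt_min hs2.1 hs0.1)
  · exact (min_le_right _ _).trans (min_le_left _ _)
  · exact (min_le_right _ _).trans (min_le_right _ _)
  · intro t φ ht htε hX
    have htr : t < r := htε.trans_le (min_le_left _ _)
    have htπ : t < π := (htε.trans_le ((min_le_right _ _).trans (min_le_left _ _))).trans hs2.2
    rw [h.frontier_eq_union] at hX
    rcases hX with (hX | hX) | hX
    · right
      rw [arc_comm] at hX
      exact direction_of_polar_mem_arc e he h0 hs0.1 hs0.2 ht htπ hX
    · left
      simpa using direction_of_polar_mem_arc e he h2 hs2.1 hs2.2 ht htπ hX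
    · exfalso
      exact hball (Metric.mem_ball.2 ((dist_polar_le e he ht.le φ).trans_lt htr)) hX

theorem isPreconnected_polar_image (e : OrthonormalBasis (Fin 3) ℝ E3) {I J : Set ℝ}
    (hI : IsPreconnected I) (hJ : IsPreconnected J) :
    IsPreconnected ((fun x : ℝ × ℝ => polar e x.1 x.2) '' I ×ˢ J) :=
  (hI.prod hJ).image _ (continuous_polar e).continuousOn

/-- Two points of the sphere on independent directions from `p` are seen under an angle that is
neither zero nor straight. -/
theorem sin_ne_zero_of_linearIndependent {e : OrthonormalBasis (Fin 3) ℝ E3} {w p u : Sph}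
    (h : LinearIndependent ℝ ![w.vec, p.vec, u.vec]) (he : e 0 = p.vec) {s s' θ : ℝ}
    (hu : u = polar e s 0) (hw : w = polar e s' θ) : sin θ ≠ 0 := by
  intro h0
  have hu' : u.vec = cos s • p.vec + sin s • e 1 := by rw [hu, polar_vec, he]; simp
  have hw' : w.vec = cos s' • p.vec + (sin s' * cos θ) • e 1 := by
    rw [hw, polar_vec, he, h0]; simp
  have hss : sin s ≠ 0 := by
    intro hss
    have := h.eq_zero_of_comb (a := 0) (b := - cos s) (c := 1) (by rw [hu', hss]; module)
    exact one_ne_zero this.2.2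
  have := h.eq_zero_of_comb (a := sin s) (b := sin s' * cos θ * cos s - sin s * cos s')
    (c := - (sin s' * cos θ)) (by rw [hu', hw']; module)
  exact hss this.1

/-- The two arcs at `q 1` cut a small disc into two connected sectors, each inside or outside of
`R`. If both were inside, the vertex would be an interior point; if both were outside, it would not
be in the closure of the interior. So exactly one of them belongs to `R`. -/
theorem IsQuadrangle.hasCorner_one {R : Set Sph} {q : Fin 4 → Sph} (h : IsQuadrangle R q) :
    ∃ θ, HasCorner R (q 1) (q 2) (q 0) θ := by
  obtain ⟨e, he, h2⟩ := exists_frame_towards (h.linearIndependent_edge 1)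
  have hs2 := sdist_pos_and_lt (h.linearIndependent_edge 1)
  have hs0 := sdist_pos_and_lt (h.linearIndependent_edge 0)
  change 0 < sdist (q 0) (q 1) ∧ sdist (q 0) (q 1) < π at hs0
  change 0 < sdist (q 1) (q 2) ∧ sdist (q 1) (q 2) < π at hs2
  change q 2 = polar e (sdist (q 1) (q 2)) 0 at h2
  rw [sdist_comm] at hs0
  obtain ⟨θ, hθ0, hθ1, h0⟩ := exists_direction e he (q 0)
  have hsin := sin_ne_zero_of_linearIndependent (h.corner 0) he h2 h0
  have hθ : 0 < θ := lt_of_le_of_ne hθ0 fun h' => hsin (by rw [← h', sin_zero])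
  obtain ⟨ε, hε, hε2, hε0, hfr⟩ := h.exists_frontier_direction he h2 h0 hs2 hs0
  have hεπ : ε < π := hε2.trans_lt hs2.2
  have hcl : closure R = R := h.isClosed.closure_eq
  have side : ∀ J : Set ℝ, IsPreconnected J → J ⊆ Icc 0 (2 * π) \ {0, θ, 2 * π} →
      (∀ t φ, 0 < t → t < ε → φ ∈ J → polar e t φ ∈ interior R) ∨
      (∀ t φ, 0 < t → t < ε → φ ∈ J → polar e t φ ∉ R) := by
    intro J hJ hJs
    have hd : Disjoint ((fun x : ℝ × ℝ => polar e x.1 x.2) '' Ioo 0 ε ×ˢ J) (frontier R) := by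
      rw [Set.disjoint_left]
      rintro _ ⟨⟨t, φ⟩, ⟨ht, hφ⟩, rfl⟩ hX
      obtain ⟨⟨hφ0, hφ1⟩, hφ2⟩ := hJs hφ
      simp only [mem_insert_iff, mem_singleton_iff, not_or] at hφ2
      have hlt : φ < 2 * π := lt_of_le_of_ne hφ1 hφ2.2.2
      rcases hfr t φ ht.1 ht.2 hX with h' | h'
      · refine hφ2.1 (angle_eq_of_cos_sin hφ0 hlt le_rfl (by linarith [pi_pos]) ?_ ?_)
        · rw [h'.1, cos_zero]
        · rw [h'.2, sin_zero]
      · exact hφ2.2.1 (angle_eq_of_cos_sin hφ0 hlt hθ0 hθ1 h'.1 h'.2)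
    rcases (isPreconnected_polar_image e isPreconnected_Ioo hJ).subset_interior_or_subset_compl hd
      with h' | h'
    · left
      intro t φ ht ht' hφ
      exact h' ⟨(t, φ), ⟨⟨ht, ht'⟩, hφ⟩, rfl⟩
    · right
      intro t φ ht ht' hφ
      rw [hcl] at h'
      exact h' ⟨(t, φ), ⟨⟨ht, ht'⟩, hφ⟩, rfl⟩
  have hfrR : frontier R ⊆ R := h.isClosed.frontier_subset
  have arc2 : ∀ t, 0 ≤ t → t < ε → polar e t 0 ∈ frontier R := by
    intro t ht ht'
    rw [h.frontier_eq_union]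
    exact Or.inl (Or.inr (polar_mem_arc e he h2 hs2.1 hs2.2 ht (ht'.le.trans hε2)))
  have arc0 : ∀ t, 0 ≤ t → t < ε → polar e t θ ∈ frontier R := by
    intro t ht ht'
    rw [h.frontier_eq_union, arc_comm (q 0)]
    exact Or.inl (Or.inl (polar_mem_arc e he h0 hs0.1 hs0.2 ht (ht'.le.trans hε0)))
  have hp0 : q 1 = polar e 0 0 := by
    apply Subtype.ext; rw [polar]; simp [he]
  have hpfr : q 1 ∈ frontier R := by rw [hp0]; exact arc2 0 le_rfl hε
  have nhd : {X : Sph | cos ε < ⟪e 0, X.vec⟫} ∈ 𝓝 (q 1) := by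
    apply IsOpen.mem_nhds
    · exact isOpen_lt continuous_const (by fun_prop)
    · rw [mem_ofPred_eq, he, (q 1).inner_self, ← cos_zero]
      exact cos_lt_cos_of_nonneg_of_le_pi le_rfl hεπ.le hε
  have pol : ∀ X : Sph, cos ε < ⟪e 0, X.vec⟫ → ∃ t φ, 0 ≤ t ∧ t < ε ∧ 0 ≤ φ ∧ φ < 2 * π ∧
      X = polar e t φ := by
    intro X hX
    obtain ⟨φ, h0, h1, h2⟩ := exists_direction e he X
    refine ⟨_, φ, InnerProductGeometry.angle_nonneg _ _, ?_, h0, h1, h2⟩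
    rw [he, Sph.inner_eq_cos] at hX
    exact lt_of_not_ge fun hle =>
      not_le.2 hX (cos_le_cos_of_nonneg_of_le_pi hε.le (InnerProductGeometry.angle_le_pi _ _) hle)
  have split : ∀ t φ, 0 ≤ t → t < ε → 0 ≤ φ → φ < 2 * π → polar e t φ ∈ frontier R ∨
      (0 < t ∧ φ ∈ Ioo 0 θ) ∨ (0 < t ∧ φ ∈ Ioo θ (2 * π)) := by
    intro t φ ht ht' hφ hφ'
    rcases ht.eq_or_lt with rfl | ht
    · left
      have : polar e 0 φ = q 1 := by
        apply Subtype.ext; rw [polar]; simp [he]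
      rw [this]; exact hpfr
    · rcases hφ.eq_or_lt with rfl | hφ
      · exact Or.inl (arc2 t ht.le ht')
      · rcases lt_trichotomy φ θ with h' | rfl | h'
        · exact Or.inr (Or.inl ⟨ht, hφ, h'⟩)
        · exact Or.inl (arc0 t ht.le ht')
        · exact Or.inr (Or.inr ⟨ht, h', hφ'⟩)
  have sub1 : Ioo 0 θ ⊆ Icc 0 (2 * π) \ {0, θ, 2 * π} := by
    intro φ hφ
    refine ⟨⟨hφ.1.le, by linarith [hφ.2]⟩, ?_⟩
    simp only [mem_insert_iff, mem_singleton_iff, not_or]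
    exact ⟨hφ.1.ne', hφ.2.ne, by linarith [hφ.2]⟩
  have sub2 : Ioo θ (2 * π) ⊆ Icc 0 (2 * π) \ {0, θ, 2 * π} := by
    intro φ hφ
    refine ⟨⟨by linarith [hφ.1], hφ.2.le⟩, ?_⟩
    simp only [mem_insert_iff, mem_singleton_iff, not_or]
    exact ⟨by linarith [hφ.1], hφ.1.ne', hφ.2.ne⟩
  rcases side _ isPreconnected_Ioo sub1 with in1 | out1 <;>
    rcases side _ isPreconnected_Ioo sub2 with in2 | out2
  · exfalso
    refine hpfr.2 (mem_interior_iff_mem_nhds.2 (mem_of_superset nhd ?_))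
    intro X hX
    obtain ⟨t, φ, ht, ht', hφ, hφ', rfl⟩ := pol X hX
    rcases split t φ ht ht' hφ hφ' with h' | ⟨h1, h2⟩ | ⟨h1, h2⟩
    · exact hfrR h'
    · exact interior_subset (in1 t φ h1 ht' h2)
    · exact interior_subset (in2 t φ h1 ht' h2)
  · exact ⟨θ, e, he, hs2, hs0, h2, h0, hθ, hθ1, ε, hε, fun t ht ht' =>
      ⟨fun φ h1 h2 => in1 t φ ht ht' ⟨h1, h2⟩, fun φ h1 h2 => out2 t φ ht ht' ⟨h1, h2⟩⟩⟩
  -- The filled sector is the complementary one: in the flipped frame it runs from 0 to `2π - θ`.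
  · obtain ⟨e', e0, e1, e2⟩ := exists_flipped_frame e
    have hpol := polar_flipped e0 e1 e2
    refine ⟨2 * π - θ, e', e0.trans he, hs2, hs0, ?_, ?_, by linarith, by linarith, ε, hε,
      fun t ht ht' => ⟨fun φ h1 h2 => ?_, fun φ h1 h2 => ?_⟩⟩
    · rw [hpol, neg_zero]; exact h2
    · rw [hpol, neg_sub, polar_sub_two_pi]; exact h0
    · rw [hpol, ← polar_add_two_pi]
      exact in2 t _ ht ht' ⟨by linarith, by linarith⟩
    · rw [hpol, ← polar_add_two_pi]
      exact out1 t _ ht ht' ⟨by linarith, by linarith⟩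
  · exfalso
    have hcl' : q 1 ∈ closure (interior R) := by rw [h.regular]; exact hfrR hpfr
    obtain ⟨X, hX, hXi⟩ := mem_closure_iff_nhds.1 hcl' _ nhd
    obtain ⟨t, φ, ht, ht', hφ, hφ', rfl⟩ := pol X hX
    rcases split t φ ht ht' hφ hφ' with h' | ⟨h1, h2⟩ | ⟨h1, h2⟩
    · exact h'.2 hXi
    · exact out1 t φ h1 ht' h2 (interior_subset hXi)
    · exact out2 t φ h1 ht' h2 (interior_subset hXi)

theorem IsQuadrangle.hasCorner {R : Set Sph} {q : Fin 4 → Sph} (h : IsQuadrangle R q)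
    (k : Fin 4) : ∃ θ, HasCorner R (q k) (q (k + 1)) (q (k + 3)) θ := by
  have := (h.rotate (k + 3)).hasCorner_one
  have e1 : 1 + (k + 3) = k := by rw [add_comm, add_assoc]; simp
  have e2 : 2 + (k + 3) = k + 1 := by rw [add_comm, add_assoc]; rfl
  simpa [e1, e2] using this

theorem HasCorner.ne_pi {R : Set Sph} {p u w : Sph} {θ : ℝ} (h : HasCorner R p u w θ)
    (hli : LinearIndependent ℝ ![w.vec, p.vec, u.vec]) : θ ≠ π := by
  obtain ⟨e, h⟩ := h
  intro h0
  exact sin_ne_zero_of_linearIndependent hli h.base h.left h.right (by rw [h0, sin_pi])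

theorem HasCorner.inner_eq {R : Set Sph} {p u w : Sph} {θ : ℝ} (h : HasCorner R p u w θ) :
    cos (sdist u w) = cos (sdist p u) * cos (sdist p w) +
      sin (sdist p u) * sin (sdist p w) * cos θ := by
  obtain ⟨e, h⟩ := h
  rw [← Sph.inner_eq_cos]
  conv_lhs => rw [h.left, h.right]
  rw [polar_vec, polar_vec, frame_inner_comb]
  simp; ring

/-- A convex region has convex corners. -/
theorem HasCorner.lt_pi {R : Set Sph} {p u w : Sph} {θ : ℝ} (h : HasCorner R p u w θ)
    (hpu : arc p u ⊆ R) (hpw : arc p w ⊆ R) (hne : θ ≠ π) (hR : IsSphConvex R) : θ < π := by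
  obtain ⟨e, h⟩ := h
  by_contra hθ
  have hθ : π < θ := lt_of_le_of_ne (not_lt.1 hθ) hne.symm
  obtain ⟨ε, hε, hsec⟩ := h.sector
  obtain ⟨t, ht, htm⟩ : ∃ t, 0 < t ∧ t < min (min ε (π / 2)) (min (sdist p u) (sdist p w)) :=
    exists_between (lt_min (lt_min hε (by positivity)) (lt_min h.dist_left.1 h.dist_right.1))
  simp only [lt_min_iff] at htm
  obtain ⟨⟨htε, htπ⟩, htu, htw⟩ := htm
  have hX := hpu (polar_mem_arc e h.base h.left h.dist_left.1 h.dist_left.2 ht.le htu.le)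
  have hY := hpw (polar_mem_arc e h.base h.right h.dist_right.1 h.dist_right.2 ht.le htw.le)
  have hct : 0 < cos t := cos_pos_of_mem_Ioo ⟨by linarith, htπ⟩
  have hst : 0 < sin t := sin_pos_of_pos_of_lt_pi ht (by linarith)
  have hne : (polar e t 0).vec ≠ -(polar e t θ).vec := by
    intro h'
    have := congrArg (fun v => ⟪e 0, v⟫) h'
    simp only [inner_neg_right, polar_inner_zero] at this
    linarith
  have hsub := hR _ hX _ hY hne
  have hκ : 0 < -cos (θ / 2) := by
    have : cos (θ / 2) < 0 :=
      cos_neg_of_pi_div_two_lt_of_lt (by linarith) (by linarith [h.lt, pi_pos])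
    linarith
  have hκ1 : -cos (θ / 2) ≤ 1 := by linarith [neg_one_le_cos (θ / 2)]
  -- The points at distance `t` on the two arcs have vector sum `2 cos t` along `e 0` plus `2 κ sin
  -- t` in the direction `θ / 2 + π`, where `κ > 0` because `θ > π`. So the midpoint of the arc
  -- joining them is at distance `arctan (κ * tan t)` from `p`, in a direction outside the sector.
  set κ := -cos (θ / 2) with hκdef
  set t' := arctan (κ * tan t) with ht'
  have htan : 0 < tan t := tan_pos_of_pos_of_lt_pi_div_two ht htπ
  have ht'0 : 0 < t' := arctan_pos.2 (by positivity)
  have ht't : t' ≤ t := by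
    rw [ht', ← arctan_tan (x := t) (by linarith) htπ]
    apply arctan_mono
    rw [arctan_tan (by linarith) htπ]
    nlinarith
  have hct' : 0 < cos t' := cos_arctan_pos _
  have hst' : sin t' = cos t' * (κ * tan t) := by
    rw [← tan_arctan (κ * tan t), ← ht', tan_eq_sin_div_cos]; field_simp
  refine (hsec t' ht'0 (ht't.trans_lt htε)).2 (θ / 2 + π) (by linarith [h.lt])
    (by linarith [h.lt]) (hsub ⟨cos t' / (2 * cos t), cos t' / (2 * cos t), by positivity,
      by positivity, ?_⟩)
  have hc2 : cos θ = 2 * κ ^ 2 - 1 := by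
    rw [hκdef, show θ = 2 * (θ / 2) by ring, cos_two_mul]; ring_nf
  have hs2 : sin θ = -2 * sin (θ / 2) * κ := by
    rw [hκdef, show θ = 2 * (θ / 2) by ring, sin_two_mul]; ring_nf
  rw [polar_vec, polar_vec, polar_vec, cos_add_pi, sin_add_pi, cos_zero, sin_zero, hst',
    hc2, hs2, tan_eq_sin_div_cos, ← hκdef]
  have a0 : cos t' = cos t' / (2 * cos t) * cos t + cos t' / (2 * cos t) * cos t := by
    field_simp; ring
  have a1 : cos t' * (κ * (sin t / cos t)) * κ = cos t' / (2 * cos t) * (sin t * 1) +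
      cos t' / (2 * cos t) * (sin t * (2 * κ ^ 2 - 1)) := by
    field_simp; ring
  have a2 : cos t' * (κ * (sin t / cos t)) * -sin (θ / 2) = cos t' / (2 * cos t) * (sin t * 0) +
      cos t' / (2 * cos t) * (sin t * (-2 * sin (θ / 2) * κ)) := by
    field_simp; ring
  rw [a1, a2]
  nth_rw 1 [a0]
  module

/-! ### Transport of corners by isometries. -/

/-- The homeomorphism of the sphere induced by a linear isometry of the ambient space. -/
noncomputable def sphereHomeo (g : E3 ≃ₗᵢ[ℝ] E3) : Sph ≃ₜ Sph where
  toFun X := ⟨g X.vec, by simp⟩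
  invFun X := ⟨g.symm X.vec, by simp⟩
  left_inv X := Subtype.ext (g.symm_apply_apply X.vec)
  right_inv X := Subtype.ext (g.apply_symm_apply X.vec)
  continuous_toFun := by fun_prop
  continuous_invFun := by fun_prop

theorem sphereHomeo_vec (g : E3 ≃ₗᵢ[ℝ] E3) (X : Sph) : (sphereHomeo g X).vec = g X.vec := rfl

theorem sdist_sphereHomeo (g : E3 ≃ₗᵢ[ℝ] E3) (X Y : Sph) :
    sdist (sphereHomeo g X) (sphereHomeo g Y) = sdist X Y := by
  rw [sdist_eq_arccos, sdist_eq_arccos, sphereHomeo_vec, sphereHomeo_vec, g.inner_map_map]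

theorem sphereHomeo_polar (g : E3 ≃ₗᵢ[ℝ] E3) (e : OrthonormalBasis (Fin 3) ℝ E3) (t φ : ℝ) :
    sphereHomeo g (polar e t φ) = polar (e.map g) t φ := by
  apply Subtype.ext
  change g (polar e t φ).vec = (polar (e.map g) t φ).vec
  simp [polar_vec]

/-- As frames of both orientations are allowed, reflections preserve corner angles just as rotations
do, so mirror-image tiles need no separate treatment. -/
theorem HasCorner.map {R R' : Set Sph} {p u w p' u' w' : Sph} {θ : ℝ} (h : HasCorner R p u w θ)
    (g : E3 ≃ₗᵢ[ℝ] E3) (hR : g '' (Sph.vec '' R) = Sph.vec '' R') (hp : g p.vec = p'.vec)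
    (hu : g u.vec = u'.vec) (hw : g w.vec = w'.vec) : HasCorner R' p' u' w' θ := by
  obtain rfl : sphereHomeo g p = p' := Subtype.ext hp
  obtain rfl : sphereHomeo g u = u' := Subtype.ext hu
  obtain rfl : sphereHomeo g w = w' := Subtype.ext hw
  obtain rfl : sphereHomeo g '' R = R' := by
    apply Subtype.val_injective.image_injective
    change Sph.vec '' _ = Sph.vec '' _
    rw [← hR, image_image, image_image]
    rfl
  obtain ⟨e, h⟩ := h
  obtain ⟨ε, hε, hsec⟩ := h.sector
  refine ⟨e.map g, ?_, ?_, ?_, ?_, ?_, h.pos, h.lt, ε, hε, fun t ht ht' =>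
    ⟨fun φ h1 h2 => ?_, fun φ h1 h2 => ?_⟩⟩
  · simp [h.base, sphereHomeo_vec]
  · rw [sdist_sphereHomeo]; exact h.dist_left
  · rw [sdist_sphereHomeo]; exact h.dist_right
  · rw [sdist_sphereHomeo, ← sphereHomeo_polar, ← h.left]
  · rw [sdist_sphereHomeo, ← sphereHomeo_polar, ← h.right]
  · rw [← sphereHomeo_polar, ← (sphereHomeo g).image_interior]
    exact mem_image_of_mem _ ((hsec t ht ht').1 φ h1 h2)
  · rw [← sphereHomeo_polar]
    rintro ⟨X, hX, hX'⟩
    rw [(sphereHomeo g).injective hX'] at hX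
    exact (hsec t ht ht').2 φ h1 h2 hX

/-! ### Angle sums around a point. -/

/-- Near `e 0`, the interior of `R` contains all directions between `lo` and `hi`. -/
def FillsSector (R : Set Sph) (e : OrthonormalBasis (Fin 3) ℝ E3) (lo hi : ℝ) : Prop :=
  ∃ ε > 0, ∀ t, 0 < t → t < ε → ∀ φ, lo < φ → φ < hi → polar e t φ ∈ interior R

theorem FillsSector.not_disjoint {R R' : Set Sph} {e : OrthonormalBasis (Fin 3) ℝ E3}
    {lo hi lo' hi' φ φ' : ℝ} (h : FillsSector R e lo hi) (h' : FillsSector R' e lo' hi')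
    (hφ : lo < φ ∧ φ < hi) (hφ' : lo' < φ' ∧ φ' < hi') (heq : ∀ t, polar e t φ = polar e t φ') :
    ¬ Disjoint (interior R) (interior R') := by
  obtain ⟨ε, hε, h⟩ := h
  obtain ⟨ε', hε', h'⟩ := h'
  obtain ⟨t, ht, htm⟩ := exists_between (lt_min hε hε')
  rw [lt_min_iff] at htm
  rw [Set.not_disjoint_iff]
  refine ⟨_, h t ht htm.1 φ hφ.1 hφ.2, ?_⟩
  rw [heq]
  exact h' t ht htm.2 φ' hφ'.1 hφ'.2

/-- A sector continuing past the direction `2π` would enter the initial sector `(0, x)` a full turn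
later. -/
theorem FillsSector.le_two_pi {R R' : Set Sph} {e : OrthonormalBasis (Fin 3) ℝ E3}
    {x lo hi : ℝ} (h : FillsSector R e 0 x) (h' : FillsSector R' e lo hi)
    (hd : Disjoint (interior R) (interior R')) (hx : 0 < x) (hlo : lo ≤ 2 * π) :
    hi ≤ 2 * π := by
  by_contra hlt
  obtain ⟨φ, hφ, hφ'⟩ := exists_between (lt_min (not_le.1 hlt) (lt_add_of_pos_right (2 * π) hx))
  rw [lt_min_iff] at hφ'
  refine h.not_disjoint h' (φ := φ - 2 * π) (φ' := φ) ⟨by linarith, by linarith⟩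
    ⟨by linarith, hφ'.1⟩ (fun t => polar_sub_two_pi e t φ) hd

/-- A corner that shares an arc with a filled sector, without overlap, lies on its other side. -/
theorem HasCorner.next {R R' : Set Sph} {e : OrthonormalBasis (Fin 3) ℝ E3} {p v w : Sph}
    {lo ψ y : ℝ} (hc : HasCorner R' p v w y) (he : e 0 = p.vec) (hlo : lo < ψ)
    (hv : v = polar e (sdist p v) ψ) (h : FillsSector R e lo ψ)
    (hd : Disjoint (interior R) (interior R')) :
    w = polar e (sdist p w) (ψ + y) ∧ FillsSector R' e ψ (ψ + y) ∧ 0 < y := by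
  obtain ⟨e', c⟩ := hc
  have h0 : e' 0 = e 0 := c.base.trans he.symm
  have hs : sin (sdist p v) ≠ 0 := (sin_pos_of_pos_of_lt_pi c.dist_left.1 c.dist_left.2).ne'
  have h1 : e' 1 = cos ψ • e 1 + sin ψ • e 2 := by
    have := congrArg Sph.vec (c.left.symm.trans hv)
    rw [polar_vec, polar_vec, h0, cos_zero, sin_zero] at this
    have h2 : sin (sdist p v) • e' 1 = sin (sdist p v) • (cos ψ • e 1 + sin ψ • e 2) := by
      rw [mul_one, mul_zero, zero_smul, add_zero, add_assoc] at this
      rw [add_left_cancel this]; module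
    exact smul_right_injective _ hs h2
  obtain ⟨ε, hε, hsec⟩ := c.sector
  rcases frame_third_eq_or_neg e e' h0 h1 with h2 | h2
  · have hpol := polar_turned h0 h1 h2
    refine ⟨(hpol _ _).symm ▸ c.right, ⟨ε, hε, fun t ht ht' φ hφ hφ' => ?_⟩, c.pos⟩
    have := (hsec t ht ht').1 (φ - ψ) (by linarith) (by linarith)
    rwa [hpol, add_sub_cancel] at this
  -- With the opposite orientation the corner would sweep backwards from `ψ`, into the sector
  -- already filled by `R`.
  · exfalso
    have hpol := polar_turned_flipped h0 h1 h2
    have h' : FillsSector R' e (ψ - y) ψ := by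
      refine ⟨ε, hε, fun t ht ht' φ hφ hφ' => ?_⟩
      have := (hsec t ht ht').1 (ψ - φ) (by linarith) (by linarith)
      rwa [hpol, sub_sub_cancel] at this
    obtain ⟨φ, hφ, hφ'⟩ := exists_between (max_lt hlo (sub_lt_self ψ c.pos))
    rw [max_lt_iff] at hφ
    exact h.not_disjoint h' (φ := φ) (φ' := φ) ⟨hφ.1, hφ'⟩ ⟨hφ.2, hφ'⟩ (fun _ => rfl) hd

theorem CornerFrame.fillsSector {R : Set Sph} {p u w : Sph} {θ : ℝ}
    {e : OrthonormalBasis (Fin 3) ℝ E3} (h : CornerFrame R p u w θ e) : FillsSector R e 0 θ := by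
  obtain ⟨ε, hε, hsec⟩ := h.sector
  exact ⟨ε, hε, fun t ht ht' => (hsec t ht ht').1⟩

/-- Coming back to the arc `p u` means having turned by a multiple of `2π`, and only one multiple is
in range. -/
theorem CornerFrame.eq_two_pi {R : Set Sph} {p u w : Sph} {θ ψ : ℝ}
    {e : OrthonormalBasis (Fin 3) ℝ E3} (h : CornerFrame R p u w θ e)
    (hu : u = polar e (sdist p u) ψ) (hψ : 0 < ψ) (hψ' : ψ ≤ 2 * π) : ψ = 2 * π := by
  rcases hψ'.eq_or_lt with h' | h'
  · exact h'
  · exfalso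
    obtain ⟨-, hc, hs⟩ := direction_eq_of_polar_eq e h.dist_left.1 h.dist_left.2 h.dist_left.1
      h.dist_left.2 (hu.symm.trans h.left)
    have := angle_eq_of_cos_sin hψ.le h' le_rfl (by linarith) hc hs
    exact hψ.ne' this

/-- Three corners around a point, without overlap. -/
theorem corner_sum_three {R₁ R₂ R₃ : Set Sph} {p u v w : Sph} {x y z : ℝ}
    (h₁ : HasCorner R₁ p u v x) (h₂ : HasCorner R₂ p v w y) (h₃ : HasCorner R₃ p w u z)
    (h₁₂ : Disjoint (interior R₁) (interior R₂)) (h₁₃ : Disjoint (interior R₁) (interior R₃))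
    (h₂₃ : Disjoint (interior R₂) (interior R₃)) : x + y + z = 2 * π := by
  obtain ⟨e, c⟩ := h₁
  have hx := c.pos
  obtain ⟨hw, f₂, hy⟩ := h₂.next c.base c.pos c.right c.fillsSector h₁₂
  obtain ⟨hu, f₃, hz⟩ := h₃.next c.base (by linarith) hw f₂ h₂₃
  have hxy := c.fillsSector.le_two_pi f₂ h₁₂ c.pos c.lt.le
  have hxyz := c.fillsSector.le_two_pi f₃ h₁₃ c.pos hxy
  exact c.eq_two_pi hu (by linarith) hxyz

/-- Four successive corners around a point, without overlap. -/
theorem corner_sum_four {R₁ R₂ R₃ R₄ : Set Sph} {p u v w r s : Sph} {x y z t : ℝ}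
    (h₁ : HasCorner R₁ p u v x) (h₂ : HasCorner R₂ p v w y) (h₃ : HasCorner R₃ p w r z)
    (h₄ : HasCorner R₄ p r s t)
    (h₁₂ : Disjoint (interior R₁) (interior R₂)) (h₁₃ : Disjoint (interior R₁) (interior R₃))
    (h₁₄ : Disjoint (interior R₁) (interior R₄)) (h₂₃ : Disjoint (interior R₂) (interior R₃))
    (h₃₄ : Disjoint (interior R₃) (interior R₄)) :
    x + y + z + t ≤ 2 * π ∧ (s = u → x + y + z + t = 2 * π) := by
  obtain ⟨e, c⟩ := h₁
  have hx := c.pos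
  obtain ⟨hw, f₂, hy⟩ := h₂.next c.base c.pos c.right c.fillsSector h₁₂
  obtain ⟨hr, f₃, hz⟩ := h₃.next c.base (by linarith) hw f₂ h₂₃
  obtain ⟨hs, f₄, ht⟩ := h₄.next c.base (by linarith) hr f₃ h₃₄
  have hxy := c.fillsSector.le_two_pi f₂ h₁₂ c.pos c.lt.le
  have hxyz := c.fillsSector.le_two_pi f₃ h₁₃ c.pos hxy
  have hxyzt := c.fillsSector.le_two_pi f₄ h₁₄ c.pos hxyz
  refine ⟨hxyzt, ?_⟩
  rintro rfl
  exact c.eq_two_pi hs (by linarith) hxyzt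

/-! ### Quadrangles with equal angles are kites. -/

theorem polar_left_vec {e : OrthonormalBasis (Fin 3) ℝ E3} {p u : Sph} {s : ℝ}
    (he : e 0 = p.vec) (h : u = polar e s 0) : u.vec = cos s • p.vec + sin s • e 1 := by
  rw [h, polar_vec, he]; simp

/-- The frames at the two ends of an edge whose last vectors are perpendicular to the edge. -/
theorem frame_across_edge {e f : OrthonormalBasis (Fin 3) ℝ E3} {p u : Sph} {s : ℝ}
    (he : e 0 = p.vec) (hf : f 0 = u.vec) (hu : u = polar e s 0) (hp : p = polar f s 0)
    (hs : 0 < s ∧ s < π) :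
    f 0 = cos s • e 0 + sin s • e 1 ∧ f 1 = sin s • e 0 - cos s • e 1 ∧
      (f 2 = e 2 ∨ f 2 = -e 2) := by
  have hss : sin s ≠ 0 := (sin_pos_of_pos_of_lt_pi hs.1 hs.2).ne'
  have h0 : f 0 = cos s • e 0 + sin s • e 1 := by
    rw [hf, he, ← polar_left_vec he hu]
  have h1 : f 1 = sin s • e 0 - cos s • e 1 := by
    have h2 := polar_left_vec hf hp
    rw [← he, ← hf, h0] at h2
    apply smul_right_injective _ hss
    change sin s • f 1 = sin s • (sin s • e 0 - cos s • e 1)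
    have h3 : sin s • f 1 = e 0 - cos s • (cos s • e 0 + sin s • e 1) := by
      exact eq_sub_of_add_eq' h2.symm
    rw [h3]
    have : sin s • (sin s • e 0 - cos s • e 1) =
        (1 - cos s ^ 2) • e 0 - (sin s * cos s) • e 1 := by
      rw [← sin_sq]; module
    rw [this]; module
  refine ⟨h0, h1, ?_⟩
  have a0 : cos s * ⟪e 0, f 2⟫ + sin s * ⟪e 1, f 2⟫ = 0 := by
    have : ⟪f 0, f 2⟫ = 0 := by rw [frame_inner]; simp
    rw [h0] at this
    simpa [inner_add_left, real_inner_smul_left] using this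
  have a1 : sin s * ⟪e 0, f 2⟫ - cos s * ⟪e 1, f 2⟫ = 0 := by
    have : ⟪f 1, f 2⟫ = 0 := by rw [frame_inner]; simp
    rw [h1] at this
    simpa [inner_sub_left, real_inner_smul_left] using this
  have cs := sin_sq_add_cos_sq s
  have b0 : ⟪e 0, f 2⟫ = 0 := by
    linear_combination cos s * a0 + sin s * a1 - ⟪e 0, f 2⟫ * cs
  have b1 : ⟪e 1, f 2⟫ = 0 := by
    linear_combination sin s * a0 - cos s * a1 - ⟪e 1, f 2⟫ * cs
  have hx := frame_expand e (f 2)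
  rw [b0, b1] at hx
  have hn : ⟪e 2, f 2⟫ ^ 2 = 1 := by
    have : ⟪f 2, f 2⟫ = 1 := by rw [frame_inner]; simp
    rw [hx, frame_inner_comb] at this
    linarith
  rcases sq_eq_one_iff.1 hn with h | h
  · left; rw [hx, h]; simp
  · right; rw [hx, h]; simp

/-- Two frames pointing at each other along an edge of a quadrangle, in both of which the region
lies to the same side of the edge, have the same normal vector. -/
theorem IsQuadrangle.normal_eq_one {R : Set Sph} {q : Fin 4 → Sph} (h : IsQuadrangle R q)
    {w w' : Sph} {θ θ' : ℝ} {e f : OrthonormalBasis (Fin 3) ℝ E3}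
    (he : CornerFrame R (q 1) (q 2) w θ e) (hf : CornerFrame R (q 2) (q 1) w' θ' f) :
    f 2 = e 2 := by
  set s := sdist (q 1) (q 2) with hs
  have hfl := hf.left
  rw [sdist_comm, ← hs] at hfl
  have hel := he.left
  rw [← hs] at hel
  have hs0 : 0 < s ∧ s < π := he.dist_left
  obtain ⟨h0, h1, h2 | h2⟩ := frame_across_edge he.base hf.base hel hfl hs0
  · exact h2
  exfalso
  -- Suppose the normals are opposite. A thin strip along the edge, on the side of `e 2`, avoids the
  -- frontier; it lies in `R` near `q 1`, hence everywhere. Near `q 2` it lies on the negative side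
  -- of `f 2`, outside the sector. The margin `δ` keeps its ends within reach of both sector
  -- descriptions.
  obtain ⟨ε, hε, hsec⟩ := he.sector
  obtain ⟨ε', hε', hsec'⟩ := hf.sector
  obtain ⟨δ, hδ, hδm⟩ := exists_between (lt_min (lt_min hε hε') (half_pos hs0.1))
  simp only [lt_min_iff] at hδm
  obtain ⟨⟨hδε, hδε'⟩, hδs⟩ := hδm
  set K := arc (q 2) (q 3) ∪ arc (q 3) (q 0) ∪ arc (q 0) (q 1) with hKdef
  have hK : IsClosed K :=
    ((isClosed_arc (h.linearIndependent_edge 2)).union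
      (isClosed_arc (h.linearIndependent_edge 3))).union
        (isClosed_arc (h.linearIndependent_edge 0))
  have hUo : IsOpen ((fun x : ℝ × ℝ => polar e x.1 x.2) ⁻¹' Kᶜ) :=
    hK.isOpen_compl.preimage (continuous_polar e)
  -- Away from its ends the edge misses the other three: the two adjacent ones because the corners
  -- are not straight, the opposite one by simplicity.
  have hseg : Icc δ (s - δ) ×ˢ {0} ⊆ (fun x : ℝ × ℝ => polar e x.1 x.2) ⁻¹' Kᶜ := by
    rintro ⟨t, φ⟩ ⟨⟨ht, ht'⟩, rfl⟩ hX
    change polar e t 0 ∈ K at hX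
    change δ ≤ t at ht
    change t ≤ s - δ at ht'
    have hmem : polar e t 0 ∈ arc (q 1) (q 2) :=
      polar_mem_arc e he.base hel hs0.1 hs0.2 (by linarith) (by linarith)
    have hst := sin_pos_of_pos_of_lt_pi (x := t) (by linarith) (by linarith)
    have hst' := sin_pos_of_pos_of_lt_pi (x := s - t) (by linarith) (by linarith)
    have hss := sin_pos_of_pos_of_lt_pi hs0.1 hs0.2
    have hvec : (polar e t 0).vec =
        (sin (s - t) / sin s) • (q 1).vec + (sin t / sin s) • (q 2).vec := by
      have e2 := polar_left_vec he.base hel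
      have e1 := polar_left_vec (u := polar e t 0) he.base rfl
      rw [e1, e2, sin_sub]
      have a1 : cos t = (sin s * cos t - cos s * sin t) / sin s + sin t / sin s * cos s := by
        field_simp; ring
      have a2 : sin t = sin t / sin s * sin s := by field_simp
      nth_rw 1 [a1]
      nth_rw 3 [a2]
      module
    rcases hX with (hX | hX) | hX
    · obtain ⟨c, d, -, -, hcd⟩ := hX
      have := (h.corner 1).eq_zero_of_comb (a := sin (s - t) / sin s) (b := sin t / sin s - c)
        (c := -d) (by
          have : (polar e t 0).vec = c • (q 2).vec + d • (q 3).vec := hcd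
          rw [hvec] at this
          change (sin (s - t) / sin s) • (q 1).vec + (sin t / sin s - c) • (q 2).vec +
            (-d) • (q 3).vec = 0
          rw [← sub_eq_zero] at this
          rw [← this]; module)
      exact (div_pos hst' hss).ne' this.1
    · exact Set.disjoint_left.1 (h.simple 1) hmem hX
    · obtain ⟨c, d, -, -, hcd⟩ := hX
      have := (h.corner 0).eq_zero_of_comb (a := -c) (b := sin (s - t) / sin s - d)
        (c := sin t / sin s) (by
          have : (polar e t 0).vec = c • (q 0).vec + d • (q 1).vec := hcd
          rw [hvec] at this
          change (-c) • (q 0).vec + (sin (s - t) / sin s - d) • (q 1).vec +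
            (sin t / sin s) • (q 2).vec = 0
          rw [← sub_eq_zero] at this
          rw [← this]; module)
      exact (div_pos hst hss).ne' this.2.2
  obtain ⟨U, V, -, hVo, hU, hV, hUV⟩ := generalized_tube_lemma isCompact_Icc isCompact_singleton
    hUo hseg
  obtain ⟨r, hr, hrV⟩ := Metric.isOpen_iff.1 hVo 0 (hV rfl)
  set m := min r π with hm
  have hm0 : 0 < m := lt_min hr pi_pos
  have hdis : Disjoint ((fun x : ℝ × ℝ => polar e x.1 x.2) '' Icc δ (s - δ) ×ˢ Ioo 0 m)
      (frontier R) := by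
    rw [Set.disjoint_left]
    rintro _ ⟨⟨t, φ⟩, ⟨ht, hφ⟩, rfl⟩ hX
    change δ ≤ t ∧ t ≤ s - δ at ht
    change 0 < φ ∧ φ < m at hφ
    have hφπ : φ < π := hφ.2.trans_le (min_le_right _ _)
    have hnK : polar e t φ ∉ K := by
      refine hUV (a := (t, φ)) ⟨hU ht, hrV ?_⟩
      rw [Metric.mem_ball, Real.dist_eq, sub_zero, abs_of_pos hφ.1]
      exact hφ.2.trans_le (min_le_left _ _)
    rw [h.frontier_eq_union] at hX
    rcases hX with (hX | hX) | (hX | hX)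
    · exact hnK (Or.inr hX)
    · have := (direction_of_polar_mem_arc e he.base hel hs0.1 hs0.2 (by linarith) (by linarith)
        hX).2
      rw [sin_zero] at this
      exact (sin_pos_of_pos_of_lt_pi hφ.1 hφπ).ne' this
    · exact hnK (Or.inl (Or.inl hX))
    · exact hnK (Or.inl (Or.inr hX))
  have hin : ∀ φ, 0 < φ → φ < m → polar e (s - δ) φ ∈ R := by
    rcases (isPreconnected_polar_image e isPreconnected_Icc
      isPreconnected_Ioo).subset_interior_or_subset_compl hdis with h' | h'
    · intro φ hφ hφ'
      exact interior_subset (h' ⟨(s - δ, φ), ⟨⟨by linarith, le_rfl⟩, hφ, hφ'⟩, rfl⟩)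
    · exfalso
      obtain ⟨φ, hφ, hφ'⟩ := exists_between (lt_min hm0 he.pos)
      rw [lt_min_iff] at hφ'
      have := h' ⟨(δ, φ), ⟨⟨le_rfl, by linarith⟩, hφ, hφ'.1⟩, rfl⟩
      exact this (subset_closure (interior_subset ((hsec δ hδ hδε).1 φ hφ hφ'.2)))
  have e0 : ∀ φ, ⟪f 0, (polar e (s - δ) φ).vec⟫ =
      cos s * cos (s - δ) + sin s * (sin (s - δ) * cos φ) := by
    intro φ
    rw [h0, inner_add_left, real_inner_smul_left, real_inner_smul_left, polar_inner_zero,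
      polar_inner_one]
  have e1 : ∀ φ, ⟪f 1, (polar e (s - δ) φ).vec⟫ =
      sin s * cos (s - δ) - cos s * (sin (s - δ) * cos φ) := by
    intro φ
    rw [h1, inner_sub_left, real_inner_smul_left, real_inner_smul_left, polar_inner_zero,
      polar_inner_one]
  have e2 : ∀ φ, ⟪f 2, (polar e (s - δ) φ).vec⟫ = -(sin (s - δ) * sin φ) := by
    intro φ
    rw [h2, inner_neg_left, polar_inner_two]
  -- The polar coordinates in `f` of the point with coordinates `(s - δ, φ)` in `e`. As `φ`
  -- decreases to 0 they tend to `(δ, 0)`, with `Φ φ < 0` since `f 2 = -e 2`.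
  let T : ℝ → ℝ := fun φ => arccos ⟪f 0, (polar e (s - δ) φ).vec⟫
  let Φ : ℝ → ℝ := fun φ => Complex.arg ⟨⟪f 1, (polar e (s - δ) φ).vec⟫,
    ⟪f 2, (polar e (s - δ) φ).vec⟫⟩
  have hT0 : T 0 = δ := by
    simp only [T, e0, cos_zero, mul_one]
    rw [← cos_sub, sub_sub_cancel, arccos_cos hδ.le (by linarith)]
  have hΦz : (⟨⟪f 1, (polar e (s - δ) 0).vec⟫, ⟪f 2, (polar e (s - δ) 0).vec⟫⟩ : ℂ) =
      ((sin δ : ℝ) : ℂ) := by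
    apply Complex.ext
    · simp only [e1, cos_zero, mul_one, Complex.ofReal_re]
      rw [← sin_sub, sub_sub_cancel]
    · simp [e2]
  have hsδ : 0 < sin δ := sin_pos_of_pos_of_lt_pi hδ (by linarith)
  have hΦ0 : Φ 0 = 0 := by
    simp only [Φ, hΦz]
    exact Complex.arg_ofReal_of_nonneg hsδ.le
  have hTc : ContinuousAt T 0 := by
    simp only [T, e0]
    fun_prop
  have hΦc : ContinuousAt Φ 0 := by
    have hc : Continuous fun φ : ℝ => (⟨⟪f 1, (polar e (s - δ) φ).vec⟫,
        ⟪f 2, (polar e (s - δ) φ).vec⟫⟩ : ℂ) := by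
      have : (fun φ : ℝ => (⟨⟪f 1, (polar e (s - δ) φ).vec⟫,
        ⟪f 2, (polar e (s - δ) φ).vec⟫⟩ : ℂ)) = fun φ : ℝ =>
          ((sin s * cos (s - δ) - cos s * (sin (s - δ) * cos φ) : ℝ) : ℂ) +
            ((-(sin (s - δ) * sin φ) : ℝ) : ℂ) * Complex.I := by
        funext φ
        rw [e1, e2, Complex.mk_eq_add_mul_I]
      rw [this]
      fun_prop
    refine ContinuousAt.comp (f := fun φ : ℝ => (⟨⟪f 1, (polar e (s - δ) φ).vec⟫,
        ⟪f 2, (polar e (s - δ) φ).vec⟫⟩ : ℂ)) (g := Complex.arg) ?_ hc.continuousAt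
    apply Complex.continuousAt_arg
    rw [hΦz]
    exact Complex.ofReal_mem_slitPlane.2 hsδ
  have ev1 : ∀ᶠ φ in 𝓝[>] (0 : ℝ), T φ < ε' :=
    (hTc.eventually (gt_mem_nhds (by rw [hT0]; exact hδε'))).filter_mono nhdsWithin_le_nhds
  have ev2 : ∀ᶠ φ in 𝓝[>] (0 : ℝ), 0 < T φ :=
    (hTc.eventually (lt_mem_nhds (by rw [hT0]; exact hδ))).filter_mono nhdsWithin_le_nhds
  have ev3 : ∀ᶠ φ in 𝓝[>] (0 : ℝ), θ' - 2 * π < Φ φ :=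
    (hΦc.eventually (lt_mem_nhds (by rw [hΦ0]; linarith [hf.lt]))).filter_mono
      nhdsWithin_le_nhds
  have ev4 : ∀ᶠ φ in 𝓝[>] (0 : ℝ), φ ∈ Ioo 0 m := Ioo_mem_nhdsGT hm0
  obtain ⟨φ, ⟨⟨hφ1, hφ2⟩, hφ3⟩, hφ, hφm⟩ := (((ev1.and ev2).and ev3).and ev4).exists
  have hneg : Φ φ < 0 := by
    apply Complex.arg_neg_iff.2
    change ⟪f 2, (polar e (s - δ) φ).vec⟫ < 0
    rw [e2]
    have := sin_pos_of_pos_of_lt_pi hφ (hφm.trans_le (min_le_right _ _))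
    have := sin_pos_of_pos_of_lt_pi (x := s - δ) (by linarith) (by linarith)
    nlinarith
  refine (hsec' (T φ) hφ2 hφ1).2 (Φ φ + 2 * π) (by linarith) (by linarith) ?_
  rw [polar_add_two_pi, ← polar_arccos_arg]
  exact hin φ hφ hφm

theorem IsQuadrangle.normal_eq {R : Set Sph} {q : Fin 4 → Sph} (h : IsQuadrangle R q)
    (k : Fin 4) {w w' : Sph} {θ θ' : ℝ} {e f : OrthonormalBasis (Fin 3) ℝ E3}
    (he : CornerFrame R (q k) (q (k + 1)) w θ e) (hf : CornerFrame R (q (k + 1)) (q k) w' θ' f) :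
    f 2 = e 2 := by
  have e1 : 1 + (k + 3) = k := by rw [add_comm, add_assoc]; simp
  have e2 : 2 + (k + 3) = k + 1 := by rw [add_comm, add_assoc]; rfl
  apply (h.rotate (k + 3)).normal_eq_one (w := w) (w' := w') (θ := θ) (θ' := θ')
  · simpa only [e1, e2] using he
  · simpa only [e1, e2] using hf

/-- A quadrangle with equal edges `q 0 q 1` and `q 1 q 2` and equal angles at `q 0` and `q 2` is
a kite. -/
theorem IsQuadrangle.kite {R : Set Sph} {q : Fin 4 → Sph} (h : IsQuadrangle R q) {α β : ℝ}
    (hd : sdist (q 0) (q 1) = sdist (q 1) (q 2)) (h0 : HasCorner R (q 0) (q 1) (q 3) α)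
    (h1 : HasCorner R (q 1) (q 2) (q 0) β) (h2 : HasCorner R (q 2) (q 3) (q 1) α) :
    sdist (q 3) (q 0) = sdist (q 2) (q 3) := by
  obtain ⟨e, c0⟩ := h0
  obtain ⟨f, c1⟩ := h1.symm
  obtain ⟨f', f'1, f'2, c1'⟩ := c1.exists_symm
  obtain ⟨k, c2⟩ := h2.symm
  -- The normals link the frames at `q 0`, `q 1` and `q 2`, so `q 3` can be computed in the frame
  -- `f` both from `q 0` and from `q 2`.
  have he2 : f 2 = e 2 := h.normal_eq 0 c0 c1
  have hk2 : k 2 = f' 2 := h.normal_eq 1 c1' c2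
  set a := sdist (q 0) (q 1) with ha
  set b := sdist (q 3) (q 0) with hb
  set c := sdist (q 2) (q 3) with hc
  have l0 := c0.left
  have r0 := c0.right
  have l1 := c1.left
  have l1' := c1'.left
  have l2 := c2.left
  have r2 := c2.right
  rw [← ha] at l0
  rw [sdist_comm, ← hb] at r0
  rw [sdist_comm, ← ha] at l1
  rw [← hd] at l1'
  rw [sdist_comm, ← hd] at l2
  rw [← hc] at r2
  have ha0 : 0 < a ∧ a < π := c0.dist_left
  have hb0 : 0 < b ∧ b < π := by rw [hb, sdist_comm]; exact c0.dist_right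
  have hc0 : 0 < c ∧ c < π := c2.dist_right
  obtain ⟨-, e1, -⟩ := frame_across_edge c1.base c0.base l1 l0 ha0
  obtain ⟨-, k1, -⟩ := frame_across_edge c1'.base c2.base l1' l2 ha0
  have v0 := polar_left_vec c1.base l1
  have v2 := polar_left_vec c1'.base l1'
  rw [← c1.base] at v0 v2
  rw [c1.base, ← c1'.base] at v2
  have hff : f' 0 = f 0 := c1'.base.trans c1.base.symm
  rw [hff, f'1] at v2
  have v3 : (q 3).vec = cos b • (q 0).vec + sin b • (cos α • (sin a • f 0 - cos a • f 1) +
      sin α • f 2) := by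
    conv_lhs => rw [r0]
    rw [polar_vec, c0.base, e1, he2]; module
  have v3' : (q 3).vec = cos c • (q 2).vec + sin c • (cos α • (sin a • f 0 -
      cos a • (cos β • f 1 + sin β • f 2)) + sin α • (sin β • f 1 - cos β • f 2)) := by
    conv_lhs => rw [r2]
    rw [polar_vec, c2.base, k1, hk2, hff, f'1, f'2]; module
  have heq : (cos b * cos a + sin b * cos α * sin a) • f 0 +
      (cos b * sin a - sin b * cos α * cos a) • f 1 + (sin b * sin α) • f 2 =
      (cos c * cos a + sin c * cos α * sin a) • f 0 +
      ((cos c * sin a - sin c * cos α * cos a) * cos β + sin c * sin α * sin β) • f 1 +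
      ((cos c * sin a - sin c * cos α * cos a) * sin β - sin c * sin α * cos β) • f 2 := by
    trans (q 3).vec
    · rw [v3, v0]; module
    · rw [v3', v2]; module
  obtain ⟨g0, g1, g2⟩ := frame_comb_inj f heq
  set Y := cos b * sin a - sin b * cos α * cos a with hY
  set Y' := cos c * sin a - sin c * cos α * cos a with hY'
  -- Let `X` be the point at distance `c` from `q 0` on the ray towards `q 3`. The reflection in the
  -- bisector at `q 1` exchanges `q 0` and `q 2` and takes `X` to `q 3`. So `q 3 - X` is a multiple
  -- of `q 0 - q 2`, while `X` is a combination of `q 0` and `q 3`; this is the linear relation in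
  -- `key`, whose coefficients vanish by independence.
  have cs := sin_sq_add_cos_sq β
  have g3 : sin β * (Y - Y') + (1 - cos β) * (sin b * sin α - sin c * sin α) = 0 := by
    linear_combination sin β * g1 + (1 - cos β) * g2 + sin c * sin α * cs
  have hsa := sin_pos_of_pos_of_lt_pi ha0.1 ha0.2
  have hsb := sin_pos_of_pos_of_lt_pi hb0.1 hb0.2
  have hβ : 1 - cos β ≠ 0 := by
    intro h'
    have := (cos_eq_one_iff_of_lt_of_lt (by linarith [c1.pos, pi_pos]) c1.lt).1
      (by linarith : cos β = 1)
    exact c1.pos.ne' this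
  have key := (h.corner 2).eq_zero_of_comb (a := sin b * (Y - Y'))
    (b := sin a * (1 - cos β) * (sin b - sin c))
    (c := sin a * (1 - cos β) * (sin b * (cos b - cos c) - cos b * (sin b - sin c)) -
      sin b * (Y - Y')) (by
      change (sin b * (Y - Y')) • (q 2).vec + (sin a * (1 - cos β) * (sin b - sin c)) • (q 3).vec +
        (sin a * (1 - cos β) * (sin b * (cos b - cos c) - cos b * (sin b - sin c)) -
        sin b * (Y - Y')) • (q 0).vec = 0
      rw [v3, v2, v0]
      have hx : sin b * (Y - Y') * cos a +
          sin a * (1 - cos β) * (sin b - sin c) * (cos b * cos a + sin b * cos α * sin a) +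
          (sin a * (1 - cos β) * (sin b * (cos b - cos c) - cos b * (sin b - sin c)) -
          sin b * (Y - Y')) * cos a = 0 := by
        linear_combination sin a * (1 - cos β) * sin b * g0
      have hy : sin b * (Y - Y') * (sin a * cos β) +
          sin a * (1 - cos β) * (sin b - sin c) * Y +
          (sin a * (1 - cos β) * (sin b * (cos b - cos c) - cos b * (sin b - sin c)) -
          sin b * (Y - Y')) * sin a = 0 := by
        rw [hY, hY']; ring
      have hz : sin b * (Y - Y') * (sin a * sin β) +
          sin a * (1 - cos β) * (sin b - sin c) * (sin b * sin α) = 0 := by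
        linear_combination sin a * sin b * g3
      trans (sin b * (Y - Y') * cos a + sin a * (1 - cos β) * (sin b - sin c) *
          (cos b * cos a + sin b * cos α * sin a) +
          (sin a * (1 - cos β) * (sin b * (cos b - cos c) - cos b * (sin b - sin c)) -
          sin b * (Y - Y')) * cos a) • f 0 + (sin b * (Y - Y') * (sin a * cos β) +
          sin a * (1 - cos β) * (sin b - sin c) * Y +
          (sin a * (1 - cos β) * (sin b * (cos b - cos c) - cos b * (sin b - sin c)) -
          sin b * (Y - Y')) * sin a) • f 1 + (sin b * (Y - Y') * (sin a * sin β) +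
          sin a * (1 - cos β) * (sin b - sin c) * (sin b * sin α)) • f 2
      · rw [hY]; module
      · rw [hx, hy, hz]; simp)
  obtain ⟨k1, k2, k3⟩ := key
  have hYY : Y - Y' = 0 := (mul_eq_zero.1 k1).resolve_left hsb.ne'
  have hab : sin a * (1 - cos β) ≠ 0 := mul_ne_zero hsa.ne' hβ
  have hsin : sin b - sin c = 0 := (mul_eq_zero.1 k2).resolve_left hab
  rw [hYY, hsin, mul_zero, mul_zero, sub_zero, sub_zero] at k3
  have hcos : cos b - cos c = 0 :=
    (mul_eq_zero.1 ((mul_eq_zero.1 k3).resolve_left hab)).resolve_left hsb.ne'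
  exact injOn_cos ⟨hb0.1.le, hb0.2.le⟩ ⟨hc0.1.le, hc0.2.le⟩ (by linarith)

theorem IsQuadrangle.arc_subset {R : Set Sph} {q : Fin 4 → Sph} (h : IsQuadrangle R q)
    (k : Fin 4) : arc (q k) (q (k + 1)) ⊆ frontier R := by
  rw [h.frontier_eq]
  exact subset_iUnion (fun k => arc (q k) (q (k + 1))) k

theorem exists_mem_arc_ne {A B : Sph} (h : LinearIndependent ℝ ![A.vec, B.vec]) :
    ∃ X ∈ arc A B, X ≠ A ∧ X ≠ B := by
  obtain ⟨e, he, hB⟩ := exists_frame_towards h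
  obtain ⟨h0, h1⟩ := sdist_pos_and_lt h
  set s := sdist A B
  have hA : A = polar e 0 0 := by apply Subtype.ext; rw [polar]; simp [he]
  have inj : ∀ t, 0 ≤ t → t ≤ π → s / 2 ≠ t → polar e (s / 2) 0 ≠ polar e t 0 := by
    intro t ht ht' hne heq
    have := congrArg (fun X : Sph => ⟪e 0, X.vec⟫) heq
    simp only [polar_inner_zero] at this
    exact hne (injOn_cos ⟨by linarith, by linarith⟩ ⟨ht, ht'⟩ this)
  refine ⟨polar e (s / 2) 0, polar_mem_arc e he hB h0 h1 (by linarith) (by linarith), ?_, ?_⟩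
  · rw [hA]; exact inj 0 le_rfl pi_pos.le (by linarith)
  · intro h2
    exact inj s h0.le h1.le (by linarith) (h2.trans hB)

/-! ### Lengths and angles of the common tile. -/

/-- The dimensions of the tile in a tiling by congruent quadrangles: `α, β, γ, δ` are the angles
at the vertices `0, 1, 2, 3` of each tile, and `a, a, c, b` are the lengths of the edges. -/
structure SphericalTiling.Dims {F : ℕ} (T : SphericalTiling F) (a b c α β γ δ : ℝ) : Prop where
  edge0 : ∀ j, sdist (T.vert j 0) (T.vert j 1) = a
  edge1 : ∀ j, sdist (T.vert j 1) (T.vert j 2) = a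
  edge2 : ∀ j, sdist (T.vert j 2) (T.vert j 3) = c
  edge3 : ∀ j, sdist (T.vert j 3) (T.vert j 0) = b
  ab : a ≠ b
  cb : c ≠ b
  corner0 : ∀ j, HasCorner (T.tile j) (T.vert j 0) (T.vert j 1) (T.vert j 3) α
  corner1 : ∀ j, HasCorner (T.tile j) (T.vert j 1) (T.vert j 2) (T.vert j 0) β
  corner2 : ∀ j, HasCorner (T.tile j) (T.vert j 2) (T.vert j 3) (T.vert j 1) γ
  corner3 : ∀ j, HasCorner (T.tile j) (T.vert j 3) (T.vert j 0) (T.vert j 2) δ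

namespace SphericalTiling

variable {F : ℕ} {T : SphericalTiling F} {a b c α β γ δ : ℝ}

theorem Congruent.exists_angles (h : T.Congruent) : ∃ θ : Fin 4 → ℝ, ∀ j k,
    HasCorner (T.tile j) (T.vert j k) (T.vert j (k + 1)) (T.vert j (k + 3)) (θ k) := by
  rcases isEmpty_or_nonempty (Fin F) with _ | ⟨⟨i⟩⟩
  · exact ⟨0, fun j => isEmptyElim j⟩
  · choose θ hθ using (T.isQuadrangle i).hasCorner
    refine ⟨θ, fun j k => ?_⟩
    obtain ⟨g, hg, hR⟩ := h i j
    exact (hθ k).map g hR (hg _) (hg _) (hg _)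

/-- Type 2 becomes the case `c = a`, so that both types are handled together. -/
theorem exists_dims (hcongr : T.Congruent)
    (htype : (∀ j, IsType2 (T.vert j) a b) ∨ (∃ c : ℝ, ∀ j, IsType4 (T.vert j) a b c))
    (hF : 0 < F) : ∃ c α β γ δ, T.Dims a b c α β γ δ := by
  obtain ⟨θ, hθ⟩ := hcongr.exists_angles
  rcases htype with h | ⟨c, h⟩
  · exact ⟨a, θ 0, θ 1, θ 2, θ 3, fun j => (h j).1, fun j => (h j).2.1, fun j => (h j).2.2.1,
      fun j => (h j).2.2.2.1, (h ⟨0, hF⟩).2.2.2.2, (h ⟨0, hF⟩).2.2.2.2, fun j => hθ j 0,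
      fun j => hθ j 1, fun j => hθ j 2, fun j => hθ j 3⟩
  · exact ⟨c, θ 0, θ 1, θ 2, θ 3, fun j => (h j).1, fun j => (h j).2.1, fun j => (h j).2.2.1,
      fun j => (h j).2.2.2.1, (h ⟨0, hF⟩).2.2.2.2.1, (h ⟨0, hF⟩).2.2.2.2.2.2.symm, fun j => hθ j 0,
      fun j => hθ j 1, fun j => hθ j 2, fun j => hθ j 3⟩

/-- With `α = γ` the tile would be a kite about the vertex 1, which gives `b = c`. -/
theorem Dims.alpha_ne_gamma (h : T.Dims a b c α β γ δ) (hF : 0 < F) : α ≠ γ := by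
  rintro rfl
  have := (T.isQuadrangle ⟨0, hF⟩).kite ((h.edge0 _).trans (h.edge1 _).symm) (h.corner0 _)
    (h.corner1 _) (h.corner2 _)
  rw [h.edge3, h.edge2] at this
  exact h.cb this.symm

/-- The same argument about the vertex 2, where now two edges of length `a` meet, would give `a =
b`. -/
theorem Dims.beta_ne_delta (h : T.Dims a b a α β γ δ) (hF : 0 < F) : β ≠ δ := by
  rintro rfl
  have := ((T.isQuadrangle ⟨0, hF⟩).rotate 1).kite ((h.edge1 _).trans (h.edge2 _).symm)
    (h.corner1 _) (h.corner2 _) (h.corner3 _)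
  exact h.ab (((h.edge0 _).symm.trans this).trans (h.edge3 _))

theorem Dims.ne_pi (h : T.Dims a b c α β γ δ) (hF : 0 < F) :
    α ≠ π ∧ β ≠ π ∧ γ ≠ π ∧ δ ≠ π :=
  have hq := (T.isQuadrangle ⟨0, hF⟩).corner
  ⟨(h.corner0 _).ne_pi (hq 3), (h.corner1 _).ne_pi (hq 0), (h.corner2 _).ne_pi (hq 1),
    (h.corner3 _).ne_pi (hq 2)⟩

theorem Dims.lt_pi (h : T.Dims a b c α β γ δ) (hF : 0 < F)
    (hconv : ∀ j, IsSphConvex (T.tile j)) : α < π ∧ β < π ∧ γ < π ∧ δ < π := by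
  have hq := T.isQuadrangle ⟨0, hF⟩
  obtain ⟨h0, h1, h2, h3⟩ := h.ne_pi hF
  have ha : ∀ k, arc (T.vert ⟨0, hF⟩ k) (T.vert ⟨0, hF⟩ (k + 1)) ⊆ T.tile ⟨0, hF⟩ :=
    fun k => (hq.arc_subset k).trans hq.isClosed.frontier_subset
  have ha' : ∀ k, arc (T.vert ⟨0, hF⟩ (k + 1)) (T.vert ⟨0, hF⟩ k) ⊆ T.tile ⟨0, hF⟩ :=
    fun k => by rw [arc_comm]; exact ha k
  exact ⟨(h.corner0 _).lt_pi (ha 0) (ha' 3) h0 (hconv _),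
    (h.corner1 _).lt_pi (ha 1) (ha' 0) h1 (hconv _),
    (h.corner2 _).lt_pi (ha 2) (ha' 1) h2 (hconv _),
    (h.corner3 _).lt_pi (ha 3) (ha' 2) h3 (hconv _)⟩

theorem _root_.HasCorner.angle_pos {R : Set Sph} {p u w : Sph} {θ : ℝ}
    (h : HasCorner R p u w θ) : 0 < θ := by
  obtain ⟨e, h⟩ := h
  exact h.pos

theorem _root_.HasCorner.sin_sdist_pos {R : Set Sph} {p u w : Sph} {θ : ℝ}
    (h : HasCorner R p u w θ) : 0 < sin (sdist p u) := by
  obtain ⟨e, h⟩ := h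
  exact sin_pos_of_pos_of_lt_pi h.dist_left.1 h.dist_left.2

theorem Dims.pos (h : T.Dims a b c α β γ δ) (hF : 0 < F) : 0 < α ∧ 0 < β ∧ 0 < γ ∧ 0 < δ :=
  ⟨(h.corner0 ⟨0, hF⟩).angle_pos, (h.corner1 ⟨0, hF⟩).angle_pos, (h.corner2 ⟨0, hF⟩).angle_pos,
    (h.corner3 ⟨0, hF⟩).angle_pos⟩

/-- In a convex quadrangle with three equal edges, the order of the angles at the middle one of
these edges determines that of the two other angles. -/
theorem Dims.order (h : T.Dims a b a α β γ δ) (hF : 0 < F)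
    (hconv : ∀ j, IsSphConvex (T.tile j)) : (β < γ ↔ δ < α) ∧ (γ < β ↔ α < δ) := by
  obtain ⟨α1, β1, γ1, δ1⟩ := h.lt_pi hF hconv
  obtain ⟨α0, β0, γ0, δ0⟩ := h.pos hF
  set i : Fin F := ⟨0, hF⟩
  have c0 := (h.corner0 i).inner_eq
  have c1 := (h.corner1 i).inner_eq
  have c2 := (h.corner2 i).inner_eq
  have c3 := (h.corner3 i).inner_eq
  have sa := (h.corner0 i).sin_sdist_pos
  have sb := (h.corner3 i).sin_sdist_pos
  rw [h.edge0] at sa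
  rw [h.edge3] at sb
  rw [h.edge0, sdist_comm (T.vert i 0) (T.vert i 3), h.edge3, sdist_comm (T.vert i 1)] at c0
  rw [h.edge1, sdist_comm (T.vert i 1) (T.vert i 0), h.edge0, sdist_comm (T.vert i 2)] at c1
  rw [h.edge2, sdist_comm (T.vert i 2) (T.vert i 1), h.edge1] at c2
  rw [h.edge3, sdist_comm (T.vert i 3) (T.vert i 2), h.edge2] at c3
  -- Each diagonal is computed from the triangles on its two sides. Subtracting the two resulting
  -- identities cancels the terms without angles.
  have key : sin a * (cos β - cos γ) = sin b * (cos δ - cos α) := by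
    apply mul_left_cancel₀ sa.ne'
    linear_combination c3 - c1 + c2 - c0
  have hβγ : ∀ x y, 0 < x → x < π → 0 < y → y < π → (x < y ↔ 0 < cos x - cos y) := by
    intro x y hx hx' hy hy'
    rw [sub_pos]
    exact (strictAntiOn_cos.lt_iff_gt ⟨hy.le, hy'.le⟩ ⟨hx.le, hx'.le⟩).symm
  constructor
  · rw [hβγ β γ β0 β1 γ0 γ1, hβγ δ α δ0 δ1 α0 α1, ← mul_pos_iff_of_pos_left sa, key,
      mul_pos_iff_of_pos_left sb]
  · rw [hβγ γ β γ0 γ1 β0 β1, hβγ α δ α0 α1 δ0 δ1, ← mul_pos_iff_of_pos_left sa,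
      show sin a * (cos γ - cos β) = sin b * (cos α - cos δ) by linear_combination -key,
      mul_pos_iff_of_pos_left sb]

/-! ### Tiles across an edge, and faces read from their edge of length `b`. -/

/-- Every edge belongs to a second tile. -/
theorem exists_other_tile (T : SphericalTiling F) (j : Fin F) (k : Fin 4) : ∃ i ≠ j, ∃ m,
    ({T.vert i m, T.vert i (m + 1)} : Set Sph) = {T.vert j k, T.vert j (k + 1)} := by
  -- A point inside the edge is a limit of points outside the tile `j`, hence lies in one of the
  -- finitely many other tiles, and on its frontier since interiors are disjoint. Not being an end
  -- point, it forces the two edges to coincide.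
  obtain ⟨X, hX, hXA, hXB⟩ := exists_mem_arc_ne ((T.isQuadrangle j).linearIndependent_edge k)
  have hXfr := (T.isQuadrangle j).arc_subset k hX
  have hcl : IsClosed (⋃ i : {i // i ≠ j}, T.tile i) :=
    isClosed_iUnion_of_finite fun i => (T.isQuadrangle i).isClosed
  have hsub : (T.tile j)ᶜ ⊆ ⋃ i : {i // i ≠ j}, T.tile i := by
    intro Y hY
    have : Y ∈ ⋃ j, T.tile j := by rw [T.cover]; trivial
    obtain ⟨i, hi⟩ := mem_iUnion.1 this
    exact mem_iUnion.2 ⟨⟨i, by rintro rfl; exact hY hi⟩, hi⟩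
  have hX' : X ∈ closure (T.tile j)ᶜ := by
    rw [frontier_eq_closure_inter_closure] at hXfr
    exact hXfr.2
  obtain ⟨⟨i, hij⟩, hXi⟩ := mem_iUnion.1 (closure_minimal hsub hcl hX')
  have hXni : X ∉ interior (T.tile i) := by
    intro hin
    have : X ∈ closure (interior (T.tile j)) := by
      rw [(T.isQuadrangle j).regular]
      exact (T.isQuadrangle j).isClosed.frontier_subset hXfr
    obtain ⟨Y, hY, hY'⟩ := mem_closure_iff.1 this _ isOpen_interior hin
    exact Set.disjoint_left.1 (T.nonoverlapping hij) hY hY'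
  have hXfi : X ∈ frontier (T.tile i) := ⟨subset_closure hXi, hXni⟩
  rw [(T.isQuadrangle i).frontier_eq] at hXfi
  obtain ⟨m, hm⟩ := mem_iUnion.1 hXfi
  refine ⟨i, hij, m, ?_⟩
  rcases T.edge_to_edge i j m k with h | h
  · exact h
  · exfalso
    rcases (h ⟨hm, hX⟩).2 with h' | h'
    · exact hXA h'
    · exact hXB h'

theorem IsFace.reverse {u v w x : Sph} (h : T.IsFace u v w x) : T.IsFace x w v u := by
  obtain ⟨j, k, h | h⟩ := h
  · exact ⟨j, k, Or.inr h⟩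
  · exact ⟨j, k, Or.inl h⟩

theorem IsFace.rotate {u v w x : Sph} (h : T.IsFace u v w x) : T.IsFace v w x u := by
  have e1 : ∀ k : Fin 4, k + 1 + 3 = k := by decide
  have e2 : ∀ k : Fin 4, k + 1 + 1 = k + 2 := by decide
  have e3 : ∀ k : Fin 4, k + 1 + 2 = k + 3 := by decide
  have e4 : ∀ k : Fin 4, k + 3 + 1 = k := by decide
  have e5 : ∀ k : Fin 4, k + 3 + 2 = k + 1 := by decide
  have e6 : ∀ k : Fin 4, k + 3 + 3 = k + 2 := by decide
  obtain ⟨j, k, ⟨h1, h2, h3, h4⟩ | ⟨h1, h2, h3, h4⟩⟩ := h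
  · exact ⟨j, k + 1, Or.inl ⟨h2, by rw [e2, h3], by rw [e3, h4], by rw [e1, h1]⟩⟩
  · exact ⟨j, k + 3, Or.inr ⟨h4, by rw [e4, h1], by rw [e5, h2], by rw [e6, h3]⟩⟩

/-- The tile `j` has the vertices `P, x, y, z` in this order, its edge of length `b` being `P x`,
with angles `ρx, ρy, ρz, ρP` at these vertices. -/
structure LabelledFace (T : SphericalTiling F) (a c α β γ δ : ℝ) (j : Fin F) (P x y z : Sph)
    (ρx ρy ρz ρP : ℝ) : Prop where
  cornerx : HasCorner (T.tile j) x P y ρx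
  cornery : HasCorner (T.tile j) y x z ρy
  cornerz : HasCorner (T.tile j) z y P ρz
  cornerP : HasCorner (T.tile j) P z x ρP
  middle : sdist y z = a
  range_eq : range (T.vert j) = {P, x, y, z}
  edge : ∃ k, ({T.vert j k, T.vert j (k + 1)} : Set Sph) = {P, z}
  cases : (ρx = α ∧ ρy = β ∧ ρz = γ ∧ ρP = δ ∧ sdist x y = a ∧ sdist z P = c) ∨
    (ρx = δ ∧ ρy = γ ∧ ρz = β ∧ ρP = α ∧ sdist x y = c ∧ sdist z P = a)

theorem range_fin_four {X : Type*} (f : Fin 4 → X) : range f = {f 3, f 0, f 1, f 2} := by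
  ext Y
  simp only [mem_range, mem_insert_iff, mem_singleton_iff]
  constructor
  · rintro ⟨k, rfl⟩
    fin_cases k <;> simp
  · rintro (h | h | h | h) <;> exact ⟨_, h.symm⟩

/-- Only the edge from vertex 3 to vertex 0 has length `b`. Reading the face from it leaves the two
directions, which are the two alternatives in `cases`. -/
theorem IsFace.labelled (h : T.Dims a b c α β γ δ) {P x y z : Sph} (hf : T.IsFace P x y z)
    (hb : sdist P x = b) :
    ∃ j ρx ρy ρz ρP, T.LabelledFace a c α β γ δ j P x y z ρx ρy ρz ρP := by
  have key : ∀ j k, sdist (T.vert j k) (T.vert j (k + 1)) = b → k = 3 := by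
    intro j k hk
    fin_cases k
    · exact absurd ((h.edge0 j).symm.trans hk) h.ab
    · exact absurd ((h.edge1 j).symm.trans hk) h.ab
    · exact absurd ((h.edge2 j).symm.trans hk) h.cb
    · rfl
  obtain ⟨j, k, ⟨rfl, rfl, rfl, rfl⟩ | ⟨rfl, rfl, rfl, rfl⟩⟩ := hf
  · obtain rfl := key j k hb
    exact ⟨j, α, β, γ, δ, (h.corner0 j).symm, (h.corner1 j).symm, (h.corner2 j).symm,
      (h.corner3 j).symm, h.edge1 j, range_fin_four _, ⟨2, pair_comm _ _⟩,
      Or.inl ⟨rfl, rfl, rfl, rfl, h.edge0 j, h.edge2 j⟩⟩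
  · have e : ∀ k : Fin 4, k + 2 + 1 = k + 3 := by decide
    rw [sdist_comm, ← e] at hb
    have hk := key j (k + 2) hb
    obtain rfl : k = 1 := by
      clear hb
      revert k
      decide
    refine ⟨j, δ, γ, β, α, h.corner3 j, h.corner2 j, h.corner1 j, h.corner0 j,
      (sdist_comm _ _).trans (h.edge1 j), ?_, ⟨0, rfl⟩,
      Or.inr ⟨rfl, rfl, rfl, rfl, (sdist_comm _ _).trans (h.edge2 j),
        (sdist_comm _ _).trans (h.edge0 j)⟩⟩
    rw [range_fin_four]
    ext Y
    simp only [mem_insert_iff, mem_singleton_iff]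
    change _ ↔ Y = T.vert j 0 ∨ Y = T.vert j 3 ∨ Y = T.vert j 2 ∨ Y = T.vert j 1
    tauto

theorem LabelledFace.exists_other_tile {j : Fin F} {P x y z : Sph} {ρx ρy ρz ρP : ℝ}
    (h : T.LabelledFace a c α β γ δ j P x y z ρx ρy ρz ρP) :
    ∃ i ≠ j, P ∈ range (T.vert i) ∧ z ∈ range (T.vert i) := by
  obtain ⟨k, hk⟩ := h.edge
  obtain ⟨i, hij, m, hm⟩ := T.exists_other_tile j k
  rw [hk] at hm
  have hsub : ({P, z} : Set Sph) ⊆ range (T.vert i) := by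
    rw [← hm]
    rintro Y (rfl | rfl)
    · exact ⟨m, rfl⟩
    · exact ⟨m + 1, rfl⟩
  exact ⟨i, hij, hsub (by simp), hsub (by simp)⟩

end SphericalTiling

/-! ### The linear equations between the angles. -/

/-- The angles of a tile are, in cyclic order, `α, β, γ, δ` or `δ, γ, β, α`. -/
def TileAngles (α β γ δ x y z p : ℝ) : Prop :=
  (x = α ∧ y = β ∧ z = γ ∧ p = δ) ∨ (x = δ ∧ y = γ ∧ z = β ∧ p = α)

theorem TileAngles.sum {α β γ δ x y z p : ℝ} (h : TileAngles α β γ δ x y z p) :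
    x + y + z + p = α + β + γ + δ := by
  rcases h with ⟨rfl, rfl, rfl, rfl⟩ | ⟨rfl, rfl, rfl, rfl⟩ <;> ring

/-- Reading tiles backwards exchanges `α` with `δ` and `β` with `γ`; hence `β < γ` may be assumed
when `β ≠ γ`. -/
theorem TileAngles.swap {α β γ δ x y z p : ℝ} (h : TileAngles α β γ δ x y z p) :
    TileAngles δ γ β α x y z p := h.symm

/-- For each choice of the eight orientations the equations are linear in `α, β, γ, δ`. They are
either inconsistent with the inequalities or force one of the excluded equalities. -/
theorem left_pattern_closed_angles_of_lt {α β γ δ n₁x n₁y n₁z n₁p n₂x n₂y n₂z n₂p n₃x n₃y n₃z n₃p n₄x n₄y n₄z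
    n₄p s₁x s₁y s₁z s₁p s₂x s₂y s₂z s₂p s₃x s₃y s₃z s₃p s₄x s₄y s₄z s₄p : ℝ}
    (n₁ : TileAngles α β γ δ n₁x n₁y n₁z n₁p) (n₂ : TileAngles α β γ δ n₂x n₂y n₂z n₂p)
    (n₃ : TileAngles α β γ δ n₃x n₃y n₃z n₃p) (n₄ : TileAngles α β γ δ n₄x n₄y n₄z n₄p)
    (s₁ : TileAngles α β γ δ s₁x s₁y s₁z s₁p) (s₂ : TileAngles α β γ δ s₂x s₂y s₂z s₂p)
    (s₃ : TileAngles α β γ δ s₃x s₃y s₃z s₃p) (s₄ : TileAngles α β γ δ s₄x s₄y s₄z s₄p)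
    (v₀ : n₁x + n₂x + s₁y = 2 * π) (v₁ : s₁x + s₂x + n₂y = 2 * π)
    (v₂ : n₂z + s₂y + n₃z = 2 * π) (v₃ : s₂z + n₃y + s₃z = 2 * π)
    (v₄ : n₃x + n₄x + s₃y = 2 * π) (v₅ : s₃x + s₄x + n₄y = 2 * π)
    (v₆ : n₁z + n₄z + s₄y = 2 * π) (v₇ : n₁y + s₁z + s₄z = 2 * π)
    (hN : n₁p + n₂p + n₃p + n₄p = 2 * π) (hS : s₁p + s₂p + s₃p + s₄p = 2 * π)
    (hα : 0 < α) (hβ : 0 < β) (hγ : 0 < γ) (hδ : 0 < δ) (hαγ : α ≠ γ) (hβδ : β ≠ δ)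
    (hβπ : β ≠ π) (hγπ : γ ≠ π)
    (hlt : β < γ) : False := by
  -- The ten vertex equations together contain every angle of the eight tiles once, so eight angle
  -- sums make `20π`.
  have hsum : α + β + γ + δ = 5 * π / 2 := by
    linarith [n₁.sum, n₂.sum, n₃.sum, n₄.sum, s₁.sum, s₂.sum, s₃.sum, s₄.sum]
  have hπ := pi_pos
  -- These four tiles settle `v₂` and `v₃`, each of which adds three angles among `β` and `γ`. As `β
  -- < γ`, both sums must contain `γ` equally often. The tiles `n₁, s₁` then complete `v₀` and `v₁`,
  -- and `n₄, s₄` the rest.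
  rcases n₃ with ⟨rfl, rfl, rfl, rfl⟩ | ⟨rfl, rfl, rfl, rfl⟩ <;>
  rcases s₂ with ⟨rfl, rfl, rfl, rfl⟩ | ⟨rfl, rfl, rfl, rfl⟩ <;>
  rcases n₂ with ⟨rfl, rfl, rfl, rfl⟩ | ⟨rfl, rfl, rfl, rfl⟩ <;>
  rcases s₃ with ⟨rfl, rfl, rfl, rfl⟩ | ⟨rfl, rfl, rfl, rfl⟩ <;>
  first
  | linarith
  | skip
  all_goals
  rcases n₁ with ⟨rfl, rfl, rfl, rfl⟩ | ⟨rfl, rfl, rfl, rfl⟩ <;>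
  rcases s₁ with ⟨rfl, rfl, rfl, rfl⟩ | ⟨rfl, rfl, rfl, rfl⟩ <;>
  first
  | linarith
  | skip
  all_goals
  rcases n₄ with ⟨rfl, rfl, rfl, rfl⟩ | ⟨rfl, rfl, rfl, rfl⟩ <;>
  rcases s₄ with ⟨rfl, rfl, rfl, rfl⟩ | ⟨rfl, rfl, rfl, rfl⟩ <;>
  first
  | linarith
  | exact hαγ (by linarith)
  | exact hβδ (by linarith)
  | exact hβπ (by linarith)
  | exact hγπ (by linarith)

theorem left_pattern_closed_angles {α β γ δ n₁x n₁y n₁z n₁p n₂x n₂y n₂z n₂p n₃x n₃y n₃z n₃p n₄x n₄y n₄z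
    n₄p s₁x s₁y s₁z s₁p s₂x s₂y s₂z s₂p s₃x s₃y s₃z s₃p s₄x s₄y s₄z s₄p : ℝ}
    (n₁ : TileAngles α β γ δ n₁x n₁y n₁z n₁p) (n₂ : TileAngles α β γ δ n₂x n₂y n₂z n₂p)
    (n₃ : TileAngles α β γ δ n₃x n₃y n₃z n₃p) (n₄ : TileAngles α β γ δ n₄x n₄y n₄z n₄p)
    (s₁ : TileAngles α β γ δ s₁x s₁y s₁z s₁p) (s₂ : TileAngles α β γ δ s₂x s₂y s₂z s₂p)
    (s₃ : TileAngles α β γ δ s₃x s₃y s₃z s₃p) (s₄ : TileAngles α β γ δ s₄x s₄y s₄z s₄p)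
    (v₀ : n₁x + n₂x + s₁y = 2 * π) (v₁ : s₁x + s₂x + n₂y = 2 * π)
    (v₂ : n₂z + s₂y + n₃z = 2 * π) (v₃ : s₂z + n₃y + s₃z = 2 * π)
    (v₄ : n₃x + n₄x + s₃y = 2 * π) (v₅ : s₃x + s₄x + n₄y = 2 * π)
    (v₆ : n₁z + n₄z + s₄y = 2 * π) (v₇ : n₁y + s₁z + s₄z = 2 * π)
    (hN : n₁p + n₂p + n₃p + n₄p = 2 * π) (hS : s₁p + s₂p + s₃p + s₄p = 2 * π)
    (hα : 0 < α) (hβ : 0 < β) (hγ : 0 < γ) (hδ : 0 < δ) (hαγ : α ≠ γ) (hβδ : β ≠ δ)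
    (hβπ : β ≠ π) (hγπ : γ ≠ π) : False := by
  rcases lt_trichotomy β γ with hlt | rfl | hlt
  · exact left_pattern_closed_angles_of_lt n₁ n₂ n₃ n₄ s₁ s₂ s₃ s₄ v₀ v₁ v₂ v₃ v₄ v₅ v₆ v₇ hN hS hα hβ hγ hδ hαγ hβδ
      hβπ hγπ hlt
  -- Here `v₂` gives `β = 2π/3`, so `α + δ = 7π/6` by `hsum`. But the two angles of `n₁` and `n₂` in
  -- `v₀` add up to `4π/3`, so they are equal, and `α` or `δ` equals `β`.
  · have hπ := pi_pos
    have hsum : α + β + β + δ = 5 * π / 2 := by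
      linarith [n₁.sum, n₂.sum, n₃.sum, n₄.sum, s₁.sum, s₂.sum, s₃.sum, s₄.sum]
    rcases n₃ with ⟨rfl, rfl, rfl, rfl⟩ | ⟨rfl, rfl, rfl, rfl⟩ <;>
    rcases s₂ with ⟨rfl, rfl, rfl, rfl⟩ | ⟨rfl, rfl, rfl, rfl⟩ <;>
    rcases n₂ with ⟨rfl, rfl, rfl, rfl⟩ | ⟨rfl, rfl, rfl, rfl⟩ <;>
    rcases n₁ with ⟨rfl, rfl, rfl, rfl⟩ | ⟨rfl, rfl, rfl, rfl⟩ <;>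
    rcases s₁ with ⟨rfl, rfl, rfl, rfl⟩ | ⟨rfl, rfl, rfl, rfl⟩ <;>
    first
    | linarith
    | skip
    all_goals
    rcases s₃ with ⟨rfl, rfl, rfl, rfl⟩ | ⟨rfl, rfl, rfl, rfl⟩ <;>
    rcases n₄ with ⟨rfl, rfl, rfl, rfl⟩ | ⟨rfl, rfl, rfl, rfl⟩ <;>
    first
    | linarith
    | exact hαγ (by linarith)
    | exact hβδ (by linarith)
  · exact left_pattern_closed_angles_of_lt n₁.swap n₂.swap n₃.swap n₄.swap s₁.swap s₂.swap s₃.swap s₄.swap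
      v₀ v₁ v₂ v₃ v₄ v₅ v₆ v₇ hN hS hδ hγ hβ hα hβδ.symm hαγ.symm hγπ hβπ hlt

/-- Without closure only `v₀` to `v₅` are available, and at the poles just inequalities. The bounds
by `π` and the ordering `δ < α` make up for the rest. -/
theorem left_pattern_convex_angles_of_lt {α β γ δ n₁x n₁y n₁z n₁p n₂x n₂y n₂z n₂p n₃x n₃y n₃z n₃p n₄x n₄y n₄z
    n₄p s₁x s₁y s₁z s₁p s₂x s₂y s₂z s₂p s₃x s₃y s₃z s₃p s₄x s₄y s₄z s₄p : ℝ}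
    (n₁ : TileAngles α β γ δ n₁x n₁y n₁z n₁p) (n₂ : TileAngles α β γ δ n₂x n₂y n₂z n₂p)
    (n₃ : TileAngles α β γ δ n₃x n₃y n₃z n₃p) (n₄ : TileAngles α β γ δ n₄x n₄y n₄z n₄p)
    (s₁ : TileAngles α β γ δ s₁x s₁y s₁z s₁p) (s₂ : TileAngles α β γ δ s₂x s₂y s₂z s₂p)
    (s₃ : TileAngles α β γ δ s₃x s₃y s₃z s₃p) (s₄ : TileAngles α β γ δ s₄x s₄y s₄z s₄p)
    (v₀ : n₁x + n₂x + s₁y = 2 * π) (v₁ : s₁x + s₂x + n₂y = 2 * π)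
    (v₂ : n₂z + s₂y + n₃z = 2 * π) (v₃ : s₂z + n₃y + s₃z = 2 * π)
    (v₄ : n₃x + n₄x + s₃y = 2 * π) (v₅ : s₃x + s₄x + n₄y = 2 * π)
    (hN : n₁p + n₂p + n₃p + n₄p ≤ 2 * π) (hS : s₁p + s₂p + s₃p + s₄p ≤ 2 * π)
    (hα : 0 < α) (hβ : 0 < β) (hγ : 0 < γ) (hδ : 0 < δ) (hαγ : α ≠ γ) (hβδ : β ≠ δ)
    (hα' : α < π) (hβ' : β < π) (hγ' : γ < π) (hδ' : δ < π)
    (hlt : β < γ) (hαδ : δ < α) : False := by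
  have hπ := pi_pos
  rcases n₃ with ⟨rfl, rfl, rfl, rfl⟩ | ⟨rfl, rfl, rfl, rfl⟩ <;>
  rcases s₂ with ⟨rfl, rfl, rfl, rfl⟩ | ⟨rfl, rfl, rfl, rfl⟩ <;>
  rcases n₂ with ⟨rfl, rfl, rfl, rfl⟩ | ⟨rfl, rfl, rfl, rfl⟩ <;>
  rcases s₃ with ⟨rfl, rfl, rfl, rfl⟩ | ⟨rfl, rfl, rfl, rfl⟩ <;>
  first
  | linarith
  | skip
  all_goals
  rcases n₁ with ⟨rfl, rfl, rfl, rfl⟩ | ⟨rfl, rfl, rfl, rfl⟩ <;>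
  rcases s₁ with ⟨rfl, rfl, rfl, rfl⟩ | ⟨rfl, rfl, rfl, rfl⟩ <;>
  first
  | linarith
  | skip
  all_goals
  rcases n₄ with ⟨rfl, rfl, rfl, rfl⟩ | ⟨rfl, rfl, rfl, rfl⟩ <;>
  rcases s₄ with ⟨rfl, rfl, rfl, rfl⟩ | ⟨rfl, rfl, rfl, rfl⟩ <;>
  first
  | linarith
  | exact hαγ (by linarith)

theorem left_pattern_convex_angles {α β γ δ n₁x n₁y n₁z n₁p n₂x n₂y n₂z n₂p n₃x n₃y n₃z n₃p n₄x n₄y n₄z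
    n₄p s₁x s₁y s₁z s₁p s₂x s₂y s₂z s₂p s₃x s₃y s₃z s₃p s₄x s₄y s₄z s₄p : ℝ}
    (n₁ : TileAngles α β γ δ n₁x n₁y n₁z n₁p) (n₂ : TileAngles α β γ δ n₂x n₂y n₂z n₂p)
    (n₃ : TileAngles α β γ δ n₃x n₃y n₃z n₃p) (n₄ : TileAngles α β γ δ n₄x n₄y n₄z n₄p)
    (s₁ : TileAngles α β γ δ s₁x s₁y s₁z s₁p) (s₂ : TileAngles α β γ δ s₂x s₂y s₂z s₂p)
    (s₃ : TileAngles α β γ δ s₃x s₃y s₃z s₃p) (s₄ : TileAngles α β γ δ s₄x s₄y s₄z s₄p)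
    (v₀ : n₁x + n₂x + s₁y = 2 * π) (v₁ : s₁x + s₂x + n₂y = 2 * π)
    (v₂ : n₂z + s₂y + n₃z = 2 * π) (v₃ : s₂z + n₃y + s₃z = 2 * π)
    (v₄ : n₃x + n₄x + s₃y = 2 * π) (v₅ : s₃x + s₄x + n₄y = 2 * π)
    (hN : n₁p + n₂p + n₃p + n₄p ≤ 2 * π) (hS : s₁p + s₂p + s₃p + s₄p ≤ 2 * π)
    (hα : 0 < α) (hβ : 0 < β) (hγ : 0 < γ) (hδ : 0 < δ) (hαγ : α ≠ γ) (hβδ : β ≠ δ)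
    (hα' : α < π) (hβ' : β < π) (hγ' : γ < π) (hδ' : δ < π)
    (hord : (β < γ ↔ δ < α) ∧ (γ < β ↔ α < δ)) : False := by
  rcases lt_trichotomy β γ with hlt | rfl | hlt
  · exact left_pattern_convex_angles_of_lt n₁ n₂ n₃ n₄ s₁ s₂ s₃ s₄ v₀ v₁ v₂ v₃ v₄ v₅ hN hS hα hβ hγ hδ hαγ hβδ
      hα' hβ' hγ' hδ' hlt (hord.1.1 hlt)
  · have hπ := pi_pos
    -- `Dims.order` yields `α = δ`. Then `v₂` and `v₀` give `β = 2π/3` and `α = 2π/3`, against `α ≠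
    -- γ`.
    have hle : α ≤ δ := not_lt.1 fun h => lt_irrefl _ (hord.1.2 h)
    have hge : δ ≤ α := not_lt.1 fun h => lt_irrefl _ (hord.2.2 h)
    rcases n₃ with ⟨rfl, rfl, rfl, rfl⟩ | ⟨rfl, rfl, rfl, rfl⟩ <;>
    rcases s₂ with ⟨rfl, rfl, rfl, rfl⟩ | ⟨rfl, rfl, rfl, rfl⟩ <;>
    rcases n₂ with ⟨rfl, rfl, rfl, rfl⟩ | ⟨rfl, rfl, rfl, rfl⟩ <;>
    rcases n₁ with ⟨rfl, rfl, rfl, rfl⟩ | ⟨rfl, rfl, rfl, rfl⟩ <;>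
    rcases s₁ with ⟨rfl, rfl, rfl, rfl⟩ | ⟨rfl, rfl, rfl, rfl⟩ <;>
    first
    | linarith
    | exact hαγ (by linarith)
  · exact left_pattern_convex_angles_of_lt n₁.swap n₂.swap n₃.swap n₄.swap s₁.swap s₂.swap s₃.swap s₄.swap
      v₀ v₁ v₂ v₃ v₄ v₅ hN hS hδ hγ hβ hα hβδ.symm hαγ.symm hδ' hγ' hβ' hα' hlt (hord.2.1 hlt)

theorem right_pattern_closed_angles_of_lt {α β γ δ n₁x n₁y n₁z n₁p n₂x n₂y n₂z n₂p n₃x n₃y n₃z n₃p n₄x n₄y n₄z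
    n₄p s₁x s₁y s₁z s₁p s₂x s₂y s₂z s₂p s₃x s₃y s₃z s₃p s₄x s₄y s₄z s₄p : ℝ}
    (n₁ : TileAngles α β γ δ n₁x n₁y n₁z n₁p) (n₂ : TileAngles α β γ δ n₂x n₂y n₂z n₂p)
    (n₃ : TileAngles α β γ δ n₃x n₃y n₃z n₃p) (n₄ : TileAngles α β γ δ n₄x n₄y n₄z n₄p)
    (s₁ : TileAngles α β γ δ s₁x s₁y s₁z s₁p) (s₂ : TileAngles α β γ δ s₂x s₂y s₂z s₂p)
    (s₃ : TileAngles α β γ δ s₃x s₃y s₃z s₃p) (s₄ : TileAngles α β γ δ s₄x s₄y s₄z s₄p)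
    (v₀ : n₁x + n₂x + s₁y = 2 * π) (v₁ : s₁x + s₂x + n₂y = 2 * π)
    (v₂ : n₂z + s₂y + n₃y = 2 * π) (v₃ : s₂z + n₃x + s₃x = 2 * π)
    (v₄ : n₃p + s₃p + n₄y = 2 * π) (v₅ : n₄x + s₄x + s₃z = 2 * π)
    (v₆ : n₁z + n₄p + s₄p = 2 * π) (v₇ : n₁y + s₁z + s₄z = 2 * π)
    (hN : n₁p + n₂p + n₃z + n₄z = 2 * π) (hS : s₁p + s₂p + s₃y + s₄y = 2 * π)
    (hα : 0 < α) (hβ : 0 < β) (hγ : 0 < γ) (hδ : 0 < δ) (hαγ : α ≠ γ) (hβδ : β ≠ δ)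
    (hβπ : β ≠ π) (hγπ : γ ≠ π)
    (hlt : β < γ) : False := by
  have hsum : α + β + γ + δ = 5 * π / 2 := by
    linarith [n₁.sum, n₂.sum, n₃.sum, n₄.sum, s₁.sum, s₂.sum, s₃.sum, s₄.sum]
  have hπ := pi_pos
  -- The first four tiles settle `v₂` and `v₃`; adding `n₄, s₄` settles `v₄` and `v₅`, and `n₁, s₁`
  -- complete all other vertices.
  rcases n₃ with ⟨rfl, rfl, rfl, rfl⟩ | ⟨rfl, rfl, rfl, rfl⟩ <;>
  rcases s₂ with ⟨rfl, rfl, rfl, rfl⟩ | ⟨rfl, rfl, rfl, rfl⟩ <;>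
  rcases n₂ with ⟨rfl, rfl, rfl, rfl⟩ | ⟨rfl, rfl, rfl, rfl⟩ <;>
  rcases s₃ with ⟨rfl, rfl, rfl, rfl⟩ | ⟨rfl, rfl, rfl, rfl⟩ <;>
  first
  | linarith
  | skip
  all_goals
  rcases n₄ with ⟨rfl, rfl, rfl, rfl⟩ | ⟨rfl, rfl, rfl, rfl⟩ <;>
  rcases s₄ with ⟨rfl, rfl, rfl, rfl⟩ | ⟨rfl, rfl, rfl, rfl⟩ <;>
  first
  | linarith
  | skip
  all_goals
  rcases n₁ with ⟨rfl, rfl, rfl, rfl⟩ | ⟨rfl, rfl, rfl, rfl⟩ <;>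
  rcases s₁ with ⟨rfl, rfl, rfl, rfl⟩ | ⟨rfl, rfl, rfl, rfl⟩ <;>
  first
  | linarith
  | exact hαγ (by linarith)
  | exact hβδ (by linarith)
  | exact hβπ (by linarith)
  | exact hγπ (by linarith)

theorem right_pattern_closed_angles {α β γ δ n₁x n₁y n₁z n₁p n₂x n₂y n₂z n₂p n₃x n₃y n₃z n₃p n₄x n₄y n₄z
    n₄p s₁x s₁y s₁z s₁p s₂x s₂y s₂z s₂p s₃x s₃y s₃z s₃p s₄x s₄y s₄z s₄p : ℝ}
    (n₁ : TileAngles α β γ δ n₁x n₁y n₁z n₁p) (n₂ : TileAngles α β γ δ n₂x n₂y n₂z n₂p)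
    (n₃ : TileAngles α β γ δ n₃x n₃y n₃z n₃p) (n₄ : TileAngles α β γ δ n₄x n₄y n₄z n₄p)
    (s₁ : TileAngles α β γ δ s₁x s₁y s₁z s₁p) (s₂ : TileAngles α β γ δ s₂x s₂y s₂z s₂p)
    (s₃ : TileAngles α β γ δ s₃x s₃y s₃z s₃p) (s₄ : TileAngles α β γ δ s₄x s₄y s₄z s₄p)
    (v₀ : n₁x + n₂x + s₁y = 2 * π) (v₁ : s₁x + s₂x + n₂y = 2 * π)
    (v₂ : n₂z + s₂y + n₃y = 2 * π) (v₃ : s₂z + n₃x + s₃x = 2 * π)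
    (v₄ : n₃p + s₃p + n₄y = 2 * π) (v₅ : n₄x + s₄x + s₃z = 2 * π)
    (v₆ : n₁z + n₄p + s₄p = 2 * π) (v₇ : n₁y + s₁z + s₄z = 2 * π)
    (hN : n₁p + n₂p + n₃z + n₄z = 2 * π) (hS : s₁p + s₂p + s₃y + s₄y = 2 * π)
    (hα : 0 < α) (hβ : 0 < β) (hγ : 0 < γ) (hδ : 0 < δ) (hαγ : α ≠ γ) (hβδ : β ≠ δ)
    (hβπ : β ≠ π) (hγπ : γ ≠ π) : False := by
  rcases lt_trichotomy β γ with hlt | rfl | hlt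
  · exact right_pattern_closed_angles_of_lt n₁ n₂ n₃ n₄ s₁ s₂ s₃ s₄ v₀ v₁ v₂ v₃ v₄ v₅ v₆ v₇ hN hS hα hβ hγ hδ hαγ hβδ
      hβπ hγπ hlt
  -- Here `v₂` gives `β = 2π/3`. The sum of `v₃` and `v₄` gives `α + δ = 4π/3`, whereas `hsum` gives
  -- `7π/6`.
  · have hπ := pi_pos
    have hsum : α + β + β + δ = 5 * π / 2 := by
      linarith [n₁.sum, n₂.sum, n₃.sum, n₄.sum, s₁.sum, s₂.sum, s₃.sum, s₄.sum]
    rcases n₃ with ⟨rfl, rfl, rfl, rfl⟩ | ⟨rfl, rfl, rfl, rfl⟩ <;>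
    rcases s₂ with ⟨rfl, rfl, rfl, rfl⟩ | ⟨rfl, rfl, rfl, rfl⟩ <;>
    rcases n₂ with ⟨rfl, rfl, rfl, rfl⟩ | ⟨rfl, rfl, rfl, rfl⟩ <;>
    rcases n₁ with ⟨rfl, rfl, rfl, rfl⟩ | ⟨rfl, rfl, rfl, rfl⟩ <;>
    rcases s₁ with ⟨rfl, rfl, rfl, rfl⟩ | ⟨rfl, rfl, rfl, rfl⟩ <;>
    first
    | linarith
    | skip
    all_goals
    rcases s₃ with ⟨rfl, rfl, rfl, rfl⟩ | ⟨rfl, rfl, rfl, rfl⟩ <;>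
    rcases n₄ with ⟨rfl, rfl, rfl, rfl⟩ | ⟨rfl, rfl, rfl, rfl⟩ <;>
    first
    | linarith
  · exact right_pattern_closed_angles_of_lt n₁.swap n₂.swap n₃.swap n₄.swap s₁.swap s₂.swap s₃.swap s₄.swap
      v₀ v₁ v₂ v₃ v₄ v₅ v₆ v₇ hN hS hδ hγ hβ hα hβδ.symm hαγ.symm hγπ hβπ hlt

theorem right_pattern_convex_angles_of_lt {α β γ δ n₁x n₁y n₁z n₁p n₂x n₂y n₂z n₂p n₃x n₃y n₃z n₃p n₄x n₄y n₄z
    n₄p s₁x s₁y s₁z s₁p s₂x s₂y s₂z s₂p s₃x s₃y s₃z s₃p s₄x s₄y s₄z s₄p : ℝ}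
    (n₁ : TileAngles α β γ δ n₁x n₁y n₁z n₁p) (n₂ : TileAngles α β γ δ n₂x n₂y n₂z n₂p)
    (n₃ : TileAngles α β γ δ n₃x n₃y n₃z n₃p) (n₄ : TileAngles α β γ δ n₄x n₄y n₄z n₄p)
    (s₁ : TileAngles α β γ δ s₁x s₁y s₁z s₁p) (s₂ : TileAngles α β γ δ s₂x s₂y s₂z s₂p)
    (s₃ : TileAngles α β γ δ s₃x s₃y s₃z s₃p) (s₄ : TileAngles α β γ δ s₄x s₄y s₄z s₄p)
    (v₀ : n₁x + n₂x + s₁y = 2 * π) (v₁ : s₁x + s₂x + n₂y = 2 * π)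
    (v₂ : n₂z + s₂y + n₃y = 2 * π) (v₃ : s₂z + n₃x + s₃x = 2 * π)
    (v₄ : n₃p + s₃p + n₄y = 2 * π) (v₅ : n₄x + s₄x + s₃z = 2 * π)
    (hN : n₁p + n₂p + n₃z + n₄z ≤ 2 * π) (hS : s₁p + s₂p + s₃y + s₄y ≤ 2 * π)
    (hα : 0 < α) (hβ : 0 < β) (hγ : 0 < γ) (hδ : 0 < δ) (hαγ : α ≠ γ) (hβδ : β ≠ δ)
    (hα' : α < π) (hβ' : β < π) (hγ' : γ < π) (hδ' : δ < π)
    (hlt : β < γ) (hαδ : δ < α) : False := by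
  have hπ := pi_pos
  rcases n₃ with ⟨rfl, rfl, rfl, rfl⟩ | ⟨rfl, rfl, rfl, rfl⟩ <;>
  rcases s₂ with ⟨rfl, rfl, rfl, rfl⟩ | ⟨rfl, rfl, rfl, rfl⟩ <;>
  rcases n₂ with ⟨rfl, rfl, rfl, rfl⟩ | ⟨rfl, rfl, rfl, rfl⟩ <;>
  rcases s₃ with ⟨rfl, rfl, rfl, rfl⟩ | ⟨rfl, rfl, rfl, rfl⟩ <;>
  rcases n₄ with ⟨rfl, rfl, rfl, rfl⟩ | ⟨rfl, rfl, rfl, rfl⟩ <;>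
  rcases s₄ with ⟨rfl, rfl, rfl, rfl⟩ | ⟨rfl, rfl, rfl, rfl⟩ <;>
  first
  | linarith
  | skip
  all_goals
  rcases n₁ with ⟨rfl, rfl, rfl, rfl⟩ | ⟨rfl, rfl, rfl, rfl⟩ <;>
  rcases s₁ with ⟨rfl, rfl, rfl, rfl⟩ | ⟨rfl, rfl, rfl, rfl⟩ <;>
  first
  | linarith
  | exact hαγ (by linarith)

theorem right_pattern_convex_angles {α β γ δ n₁x n₁y n₁z n₁p n₂x n₂y n₂z n₂p n₃x n₃y n₃z n₃p n₄x n₄y n₄z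
    n₄p s₁x s₁y s₁z s₁p s₂x s₂y s₂z s₂p s₃x s₃y s₃z s₃p s₄x s₄y s₄z s₄p : ℝ}
    (n₁ : TileAngles α β γ δ n₁x n₁y n₁z n₁p) (n₂ : TileAngles α β γ δ n₂x n₂y n₂z n₂p)
    (n₃ : TileAngles α β γ δ n₃x n₃y n₃z n₃p) (n₄ : TileAngles α β γ δ n₄x n₄y n₄z n₄p)
    (s₁ : TileAngles α β γ δ s₁x s₁y s₁z s₁p) (s₂ : TileAngles α β γ δ s₂x s₂y s₂z s₂p)
    (s₃ : TileAngles α β γ δ s₃x s₃y s₃z s₃p) (s₄ : TileAngles α β γ δ s₄x s₄y s₄z s₄p)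
    (v₀ : n₁x + n₂x + s₁y = 2 * π) (v₁ : s₁x + s₂x + n₂y = 2 * π)
    (v₂ : n₂z + s₂y + n₃y = 2 * π) (v₃ : s₂z + n₃x + s₃x = 2 * π)
    (v₄ : n₃p + s₃p + n₄y = 2 * π) (v₅ : n₄x + s₄x + s₃z = 2 * π)
    (hN : n₁p + n₂p + n₃z + n₄z ≤ 2 * π) (hS : s₁p + s₂p + s₃y + s₄y ≤ 2 * π)
    (hα : 0 < α) (hβ : 0 < β) (hγ : 0 < γ) (hδ : 0 < δ) (hαγ : α ≠ γ) (hβδ : β ≠ δ)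
    (hα' : α < π) (hβ' : β < π) (hγ' : γ < π) (hδ' : δ < π)
    (hord : (β < γ ↔ δ < α) ∧ (γ < β ↔ α < δ)) : False := by
  rcases lt_trichotomy β γ with hlt | rfl | hlt
  · exact right_pattern_convex_angles_of_lt n₁ n₂ n₃ n₄ s₁ s₂ s₃ s₄ v₀ v₁ v₂ v₃ v₄ v₅ hN hS hα hβ hγ hδ hαγ hβδ
      hα' hβ' hγ' hδ' hlt (hord.1.1 hlt)
  · have hπ := pi_pos
    -- Now `α = δ`, and `v₂`, `v₃` make all four angles equal to `2π/3`; four of them exceed `2π` at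
    -- a pole.
    have hle : α ≤ δ := not_lt.1 fun h => lt_irrefl _ (hord.1.2 h)
    have hge : δ ≤ α := not_lt.1 fun h => lt_irrefl _ (hord.2.2 h)
    rcases n₃ with ⟨rfl, rfl, rfl, rfl⟩ | ⟨rfl, rfl, rfl, rfl⟩ <;>
    rcases s₂ with ⟨rfl, rfl, rfl, rfl⟩ | ⟨rfl, rfl, rfl, rfl⟩ <;>
    rcases n₂ with ⟨rfl, rfl, rfl, rfl⟩ | ⟨rfl, rfl, rfl, rfl⟩ <;>
    rcases n₁ with ⟨rfl, rfl, rfl, rfl⟩ | ⟨rfl, rfl, rfl, rfl⟩ <;>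
    rcases s₁ with ⟨rfl, rfl, rfl, rfl⟩ | ⟨rfl, rfl, rfl, rfl⟩ <;>
    rcases s₃ with ⟨rfl, rfl, rfl, rfl⟩ | ⟨rfl, rfl, rfl, rfl⟩ <;>
    rcases n₄ with ⟨rfl, rfl, rfl, rfl⟩ | ⟨rfl, rfl, rfl, rfl⟩ <;>
    first
    | linarith
  · exact right_pattern_convex_angles_of_lt n₁.swap n₂.swap n₃.swap n₄.swap s₁.swap s₂.swap s₃.swap s₄.swap
      v₀ v₁ v₂ v₃ v₄ v₅ hN hS hδ hγ hβ hα hβδ.symm hαγ.symm hδ' hγ' hβ' hα' hlt (hord.2.1 hlt)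

/-! ### The eight tiles of a wheel. -/

namespace SphericalTiling

variable {F : ℕ} {T : SphericalTiling F} {N S : Sph} {v : ℤ → Sph}

/-- The two excluded pairs of indices are the identifications allowed when the wheel closes up. -/
theorem IsWheelPart.ne (w : T.IsWheelPart N S v) {k l : ℤ} (hk : -2 ≤ k) (hkl : k < l)
    (hl : l ≤ 7) (h1 : ¬ (k = -2 ∧ l = 6)) (h2 : ¬ (k = -1 ∧ l = 7)) (hk5 : k ≤ 4) :
    v k ≠ v l := by
  intro h
  rcases w.distinct with hi | ⟨hi, h6, h7⟩
  · exact hkl.ne (hi ⟨hk, by omega⟩ ⟨by omega, hl⟩ h)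
  · obtain hl' | rfl | rfl : l ≤ 5 ∨ l = 6 ∨ l = 7 := by omega
    · exact hkl.ne (hi ⟨hk, by omega⟩ ⟨by omega, hl'⟩ h)
    · have := hi ⟨hk, by omega⟩ ⟨le_rfl, by norm_num⟩ (h.trans h6)
      exact h1 ⟨this, rfl⟩
    · have := hi ⟨hk, by omega⟩ ⟨by norm_num, by norm_num⟩ (h.trans h7)
      exact h2 ⟨this, rfl⟩

/-- The tiles `n i` and `s i` are the displayed tiles of a wheel. -/
structure WheelTiles (T : SphericalTiling F) (N S : Sph) (v : ℤ → Sph) (n s : Fin 4 → Fin F) :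
    Prop where
  wheel : T.IsWheelPart N S v
  north : ∀ i : Fin 4, range (T.vert (n i)) =
    {N, v (2 * (i : ℕ) - 2), v (2 * (i : ℕ) - 1), v (2 * (i : ℕ))}
  south : ∀ i : Fin 4, range (T.vert (s i)) =
    {S, v (2 * (i : ℕ) - 1), v (2 * (i : ℕ)), v (2 * (i : ℕ) + 1)}

variable {n s : Fin 4 → Fin F}

theorem WheelTiles.north_mem (h : T.WheelTiles N S v n s) (i : Fin 4) :
    N ∈ range (T.vert (n i)) := by
  rw [h.north]; simp

theorem WheelTiles.north_notMem (h : T.WheelTiles N S v n s) (i : Fin 4) :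
    N ∉ range (T.vert (s i)) := by
  have hi := i.2
  rw [h.south]
  simp only [mem_insert_iff, mem_singleton_iff, not_or]
  exact ⟨h.wheel.poles_ne, (h.wheel.ne_pole _ ⟨by omega, by omega⟩).1.symm,
    (h.wheel.ne_pole _ ⟨by omega, by omega⟩).1.symm,
    (h.wheel.ne_pole _ ⟨by omega, by omega⟩).1.symm⟩

theorem WheelTiles.ne (h : T.WheelTiles N S v n s) (i j : Fin 4) : n i ≠ s j := by
  intro h'
  have := h.north_mem i
  rw [h'] at this
  exact h.north_notMem j this

theorem WheelTiles.north_ne_of_lt (h : T.WheelTiles N S v n s) {i j : Fin 4} (hij : i < j) :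
    n i ≠ n j := by
  intro h'
  have hij' : (i : ℕ) < j := hij
  have hj := j.2
  -- The middle vertex of the earlier tile distinguishes it from the later ones; an end vertex would
  -- not do, as `v (-2)` may be `v 6`.
  have hmem : v (2 * (i : ℕ) - 1) ∈ range (T.vert (n i)) := by rw [h.north]; simp
  rw [h', h.north] at hmem
  simp only [mem_insert_iff, mem_singleton_iff] at hmem
  rcases hmem with h1 | h1 | h1 | h1
  · exact (h.wheel.ne_pole _ ⟨by omega, by omega⟩).1 h1
  all_goals
    refine h.wheel.ne ?_ ?_ ?_ ?_ ?_ ?_ h1 <;> omega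

theorem WheelTiles.south_ne_of_lt (h : T.WheelTiles N S v n s) {i j : Fin 4} (hij : i < j) :
    s i ≠ s j := by
  intro h'
  have hij' : (i : ℕ) < j := hij
  have hj := j.2
  have hmem : v (2 * (i : ℕ)) ∈ range (T.vert (s i)) := by rw [h.south]; simp
  rw [h', h.south] at hmem
  simp only [mem_insert_iff, mem_singleton_iff] at hmem
  rcases hmem with h1 | h1 | h1 | h1
  · exact (h.wheel.ne_pole _ ⟨by omega, by omega⟩).2 h1
  all_goals
    refine h.wheel.ne ?_ ?_ ?_ ?_ ?_ ?_ h1 <;> omega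

theorem WheelTiles.injective (h : T.WheelTiles N S v n s) :
    Function.Injective (Sum.elim n s) := by
  have hn : Function.Injective n := fun i j hij => by
    rcases lt_trichotomy i j with h' | h' | h'
    · exact absurd hij (h.north_ne_of_lt h')
    · exact h'
    · exact absurd hij.symm (h.north_ne_of_lt h')
  have hs : Function.Injective s := fun i j hij => by
    rcases lt_trichotomy i j with h' | h' | h'
    · exact absurd hij (h.south_ne_of_lt h')
    · exact h'
    · exact absurd hij.symm (h.south_ne_of_lt h')
  exact hn.sumElim hs h.ne

theorem WheelTiles.eight_le (h : T.WheelTiles N S v n s) : 8 ≤ F := by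
  simpa using Fintype.card_le_of_injective _ h.injective

/-- A wheel in a tiling by eight tiles closes up. -/
theorem WheelTiles.closed (h : T.WheelTiles N S v n s) (hF : F = 8)
    (hedge : ∃ i ≠ n 3, N ∈ range (T.vert i) ∧ v 6 ∈ range (T.vert i)) :
    v 6 = v (-2) ∧ v 7 = v (-1) := by
  rcases h.wheel.distinct with hi | ⟨-, h6, h7⟩
  · exfalso
    -- The displayed tiles are all the tiles. The one across the edge `N (v 6)` contains `N`, so it
    -- is an earlier northern tile, and these miss `v 6` if the path is injective.
    have hb : Function.Bijective (Sum.elim n s) :=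
      (Fintype.bijective_iff_injective_and_card _).2 ⟨h.injective, by simp [hF]⟩
    obtain ⟨i, hi3, hiN, hi6⟩ := hedge
    obtain ⟨i | i, rfl⟩ := hb.2 i
    · change n i ≠ n 3 at hi3
      change v 6 ∈ range (T.vert (n i)) at hi6
      have h3 : i ≠ 3 := fun h' => hi3 (by rw [h'])
      have hi2 : (i : ℕ) < 3 := by
        have := i.2
        have : (i : ℕ) ≠ 3 := fun h' => h3 (Fin.ext h')
        omega
      rw [h.north] at hi6
      simp only [mem_insert_iff, mem_singleton_iff] at hi6
      rcases hi6 with h1 | h1 | h1 | h1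
      · exact (h.wheel.ne_pole _ ⟨by omega, by omega⟩).1 h1
      all_goals
        have := hi ⟨by omega, by omega⟩ ⟨by omega, by omega⟩ h1
        omega
    · exact h.north_notMem i hiN
  · exact ⟨h6, h7⟩

theorem LabelledFace.tileAngles {a c α β γ δ : ℝ} {j : Fin F} {P x y z : Sph}
    {ρx ρy ρz ρP : ℝ} (h : T.LabelledFace a c α β γ δ j P x y z ρx ρy ρz ρP) :
    TileAngles α β γ δ ρx ρy ρz ρP := by
  rcases h.cases with ⟨h1, h2, h3, h4, -, -⟩ | ⟨h1, h2, h3, h4, -, -⟩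
  · exact Or.inl ⟨h1, h2, h3, h4⟩
  · exact Or.inr ⟨h1, h2, h3, h4⟩

theorem LabelledFace.eq_of_left {a c α β γ δ : ℝ} (hac : a ≠ c) {j : Fin F} {P x y z : Sph}
    {ρx ρy ρz ρP : ℝ} (h : T.LabelledFace a c α β γ δ j P x y z ρx ρy ρz ρP)
    (hxy : sdist x y = a) : ρx = α ∧ ρy = β ∧ ρz = γ ∧ ρP = δ ∧ sdist z P = c := by
  rcases h.cases with ⟨h1, h2, h3, h4, -, h5⟩ | ⟨h1, h2, h3, h4, h5, -⟩
  · exact ⟨h1, h2, h3, h4, h5⟩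
  · exact absurd (hxy.symm.trans h5) hac

theorem LabelledFace.eq_of_right {a c α β γ δ : ℝ} (hac : a ≠ c) {j : Fin F} {P x y z : Sph}
    {ρx ρy ρz ρP : ℝ} (h : T.LabelledFace a c α β γ δ j P x y z ρx ρy ρz ρP)
    (hzP : sdist z P = c) : ρx = α ∧ ρy = β ∧ ρz = γ ∧ ρP = δ ∧ sdist x y = a := by
  rcases h.cases with ⟨h1, h2, h3, h4, h5, -⟩ | ⟨h1, h2, h3, h4, -, h5⟩
  · exact ⟨h1, h2, h3, h4, h5⟩
  · exact absurd (h5.symm.trans hzP) hac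

/-- In the left pattern two unequal edges adjacent to the edge of length `b` are impossible. -/
theorem left_pattern_unequal {a c α β γ δ : ℝ} (hac : a ≠ c) {n₁ n₂ n₃ s₁ s₂ s₃ : Fin F}
    {n₁x n₁y n₁z n₁p n₂x n₂y n₂z n₂p n₃x n₃y n₃z n₃p
      s₁x s₁y s₁z s₁p s₂x s₂y s₂z s₂p s₃x s₃y s₃z s₃p : ℝ}
    (N₁ : T.LabelledFace a c α β γ δ n₁ N (v 0) (v (-1)) (v (-2)) n₁x n₁y n₁z n₁p)
    (N₂ : T.LabelledFace a c α β γ δ n₂ N (v 0) (v 1) (v 2) n₂x n₂y n₂z n₂p)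
    (N₃ : T.LabelledFace a c α β γ δ n₃ N (v 4) (v 3) (v 2) n₃x n₃y n₃z n₃p)
    (S₁ : T.LabelledFace a c α β γ δ s₁ S (v 1) (v 0) (v (-1)) s₁x s₁y s₁z s₁p)
    (S₂ : T.LabelledFace a c α β γ δ s₂ S (v 1) (v 2) (v 3) s₂x s₂y s₂z s₂p)
    (S₃ : T.LabelledFace a c α β γ δ s₃ S (v 5) (v 4) (v 3) s₃x s₃y s₃z s₃p)
    (v₀ : n₁x + n₂x + s₁y = 2 * π) (v₂ : n₂z + s₂y + n₃z = 2 * π) : α = γ := by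
  -- The edge opposite to the `b`-edge always has length `a`. Where it is adjacent to the `b`-edge
  -- of the neighbouring tile, it fixes the orientation of that tile.
  obtain ⟨n1, -⟩ := N₁.eq_of_left hac S₁.middle
  obtain ⟨-, s2, -⟩ := S₂.eq_of_left hac N₂.middle
  obtain ⟨-, -, n3, -, hN3⟩ := N₃.eq_of_left hac S₃.middle
  obtain ⟨n2x, -, n2z, -, hN2⟩ := N₂.eq_of_right hac hN3
  obtain ⟨-, s1, -⟩ := S₁.eq_of_left hac ((sdist_comm _ _).trans hN2)
  -- The equations have become `2α + β = 2π` and `β + 2γ = 2π`.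
  linarith

/-- In the right pattern two unequal edges adjacent to the edge of length `b` are impossible. -/
theorem right_pattern_unequal {a c α β γ δ : ℝ} (hac : a ≠ c) {n₃ n₄ s₂ : Fin F}
    {n₃x n₃y n₃z n₃p n₄x n₄y n₄z n₄p s₂x s₂y s₂z s₂p : ℝ}
    (N₃ : T.LabelledFace a c α β γ δ n₃ (v 4) (v 3) (v 2) N n₃x n₃y n₃z n₃p)
    (N₄ : T.LabelledFace a c α β γ δ n₄ (v 6) (v 5) (v 4) N n₄x n₄y n₄z n₄p)
    (S₂ : T.LabelledFace a c α β γ δ s₂ S (v 1) (v 2) (v 3) s₂x s₂y s₂z s₂p) : False := by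
  -- The edge `v 2, v 3` is opposite to the `b`-edge in `S₂`, so it has length `a` and `N₃` gives
  -- `N, v 4` the length `c`. But that edge is opposite to the `b`-edge in `N₄`.
  obtain ⟨-, -, -, -, h⟩ := N₃.eq_of_left hac ((sdist_comm _ _).trans S₂.middle)
  exact hac (N₄.middle.symm.trans ((sdist_comm _ _).trans h))

end SphericalTiling

/-! ### Excluding the two patterns. -/

namespace SphericalTiling

variable {F : ℕ} {T : SphericalTiling F} {N S : Sph} {v : ℤ → Sph} {a b c α β γ δ : ℝ}

theorem IsWheelPart.faces (w : T.IsWheelPart N S v) :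
    (T.IsFace N (v (-2)) (v (-1)) (v 0) ∧ T.IsFace N (v 0) (v 1) (v 2) ∧
      T.IsFace N (v 2) (v 3) (v 4) ∧ T.IsFace N (v 4) (v 5) (v 6)) ∧
    T.IsFace S (v (-1)) (v 0) (v 1) ∧ T.IsFace S (v 1) (v 2) (v 3) ∧
      T.IsFace S (v 3) (v 4) (v 5) ∧ T.IsFace S (v 5) (v 6) (v 7) :=
  ⟨⟨w.north_face (-2) (by simp), w.north_face 0 (by simp), w.north_face 2 (by simp),
    w.north_face 4 (by simp)⟩, w.south_face (-1) (by simp), w.south_face 1 (by simp),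
    w.south_face 3 (by simp), w.south_face 5 (by simp)⟩

theorem wheelTiles_of_ranges (w : T.IsWheelPart N S v) {n₁ n₂ n₃ n₄ s₁ s₂ s₃ s₄ : Fin F}
    (hn₁ : range (T.vert n₁) = {N, v (-2), v (-1), v 0})
    (hn₂ : range (T.vert n₂) = {N, v 0, v 1, v 2})
    (hn₃ : range (T.vert n₃) = {N, v 2, v 3, v 4})
    (hn₄ : range (T.vert n₄) = {N, v 4, v 5, v 6})
    (hs₁ : range (T.vert s₁) = {S, v (-1), v 0, v 1})
    (hs₂ : range (T.vert s₂) = {S, v 1, v 2, v 3})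
    (hs₃ : range (T.vert s₃) = {S, v 3, v 4, v 5})
    (hs₄ : range (T.vert s₄) = {S, v 5, v 6, v 7}) :
    T.WheelTiles N S v ![n₁, n₂, n₃, n₄] ![s₁, s₂, s₃, s₄] where
  wheel := w
  north i := by
    fin_cases i
    · simpa using hn₁
    · simpa using hn₂
    · simpa using hn₃
    · simpa using hn₄
  south i := by
    fin_cases i
    · simpa using hs₁
    · simpa using hs₂
    · simpa using hs₃
    · simpa using hs₄

theorem insert_rotate_three {X : Type*} (p x y z : X) : ({p, z, y, x} : Set X) = {p, x, y, z} := by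
  ext; simp only [mem_insert_iff, mem_singleton_iff]; tauto

/-- Three labelled corners of pairwise different tiles around a vertex. -/
theorem sum_three {i j k : Fin F} {p u w r : Sph} {x y z : ℝ} (hij : i ≠ j) (hik : i ≠ k)
    (hjk : j ≠ k) (h₁ : HasCorner (T.tile i) p u w x) (h₂ : HasCorner (T.tile j) p w r y)
    (h₃ : HasCorner (T.tile k) p r u z) : x + y + z = 2 * π :=
  corner_sum_three h₁ h₂ h₃ (T.nonoverlapping hij) (T.nonoverlapping hik) (T.nonoverlapping hjk)

theorem sum_four {i : Fin 4 → Fin F} (hi : Function.Injective i) {p u₀ u₁ u₂ u₃ u₄ : Sph}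
    {x y z t : ℝ} (h₁ : HasCorner (T.tile (i 0)) p u₀ u₁ x)
    (h₂ : HasCorner (T.tile (i 1)) p u₁ u₂ y) (h₃ : HasCorner (T.tile (i 2)) p u₂ u₃ z)
    (h₄ : HasCorner (T.tile (i 3)) p u₃ u₄ t) :
    x + y + z + t ≤ 2 * π ∧ (u₄ = u₀ → x + y + z + t = 2 * π) := by
  have d : ∀ k l : Fin 4, k ≠ l → Disjoint (interior (T.tile (i k))) (interior (T.tile (i l))) :=
    fun k l h => T.nonoverlapping (hi.ne h)
  exact corner_sum_four h₁ h₂ h₃ h₄ (d _ _ (by decide)) (d _ _ (by decide)) (d _ _ (by decide))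
    (d _ _ (by decide)) (d _ _ (by decide))

theorem not_leftPattern (h : T.Dims a b c α β γ δ)
    (hF : (∀ j, IsSphConvex (T.tile j)) ∨ F = 6 ∨ F = 8) (hp : T.LeftPattern b N S v) :
    False := by
  obtain ⟨⟨f₁, f₂, f₃, f₄⟩, g₁, g₂, g₃, g₄⟩ := hp.wheel.faces
  -- Each face is re-read so that its edge of length `b` comes first.
  obtain ⟨n₁, n₁x, n₁y, n₁z, n₁p, N₁⟩ := f₁.rotate.reverse.labelled h hp.edge1
  obtain ⟨n₂, n₂x, n₂y, n₂z, n₂p, N₂⟩ := f₂.labelled h hp.edge1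
  obtain ⟨n₃, n₃x, n₃y, n₃z, n₃p, N₃⟩ := f₃.rotate.reverse.labelled h hp.edge3
  obtain ⟨n₄, n₄x, n₄y, n₄z, n₄p, N₄⟩ := f₄.labelled h hp.edge3
  obtain ⟨s₁, s₁x, s₁y, s₁z, s₁p, S₁⟩ := g₁.rotate.reverse.labelled h hp.edge2
  obtain ⟨s₂, s₂x, s₂y, s₂z, s₂p, S₂⟩ := g₂.labelled h hp.edge2
  obtain ⟨s₃, s₃x, s₃y, s₃z, s₃p, S₃⟩ := g₃.rotate.reverse.labelled h hp.edge4
  obtain ⟨s₄, s₄x, s₄y, s₄z, s₄p, S₄⟩ := g₄.labelled h hp.edge4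
  have W := wheelTiles_of_ranges hp.wheel
    (N₁.range_eq.trans (insert_rotate_three _ _ _ _)) N₂.range_eq
    (N₃.range_eq.trans (insert_rotate_three _ _ _ _)) N₄.range_eq
    (S₁.range_eq.trans (insert_rotate_three _ _ _ _)) S₂.range_eq
    (S₃.range_eq.trans (insert_rotate_three _ _ _ _)) S₄.range_eq
  have hinj := W.injective
  have nne : ∀ i j : Fin 4, i ≠ j → ![n₁, n₂, n₃, n₄] i ≠ ![n₁, n₂, n₃, n₄] j :=
    fun i j hij => (hinj.comp Sum.inl_injective).ne hij
  have sne : ∀ i j : Fin 4, i ≠ j → ![s₁, s₂, s₃, s₄] i ≠ ![s₁, s₂, s₃, s₄] j :=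
    fun i j hij => (hinj.comp Sum.inr_injective).ne hij
  have nsne := W.ne
  have hF0 : 0 < F := by have := W.eight_le; omega
  have v₀ : n₁x + n₂x + s₁y = 2 * π :=
    sum_three (nne 0 1 (by decide)) (nsne 0 0) (nsne 1 0) N₁.cornerx.symm N₂.cornerx S₁.cornery
  have v₁ : s₁x + s₂x + n₂y = 2 * π :=
    sum_three (sne 0 1 (by decide)) (nsne 1 0).symm (nsne 1 1).symm S₁.cornerx.symm S₂.cornerx
      N₂.cornery.symm
  have v₂ : n₂z + s₂y + n₃z = 2 * π := by
    have := sum_three (nsne 1 1) (nne 1 2 (by decide)) (nsne 2 1).symm N₂.cornerz.symm S₂.cornery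
      N₃.cornerz
    exact this
  have v₃ : s₂z + n₃y + s₃z = 2 * π :=
    sum_three (nsne 2 1).symm (sne 1 2 (by decide)) (nsne 2 2) S₂.cornerz.symm N₃.cornery.symm
      S₃.cornerz
  have v₄ : n₃x + n₄x + s₃y = 2 * π :=
    sum_three (nne 2 3 (by decide)) (nsne 2 2) (nsne 3 2) N₃.cornerx.symm N₄.cornerx S₃.cornery
  have v₅ : s₃x + s₄x + n₄y = 2 * π :=
    sum_three (sne 2 3 (by decide)) (nsne 3 2).symm (nsne 3 3).symm S₃.cornerx.symm S₄.cornerx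
      N₄.cornery.symm
  obtain ⟨hN, hN'⟩ := sum_four (hinj.comp Sum.inl_injective) N₁.cornerP N₂.cornerP.symm
    N₃.cornerP N₄.cornerP.symm
  obtain ⟨hS, hS'⟩ := sum_four (hinj.comp Sum.inr_injective) S₁.cornerP S₂.cornerP.symm
    S₃.cornerP S₄.cornerP.symm
  obtain ⟨hα, hβ, hγ, hδ⟩ := h.pos hF0
  by_cases hac : a = c
  swap
  · exact h.alpha_ne_gamma hF0 (left_pattern_unequal hac N₁ N₂ N₃ S₁ S₂ S₃ v₀ v₂)
  subst hac
  rcases hF with hF | hF | hF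
  · obtain ⟨hα', hβ', hγ', hδ'⟩ := h.lt_pi hF0 hF
    exact left_pattern_convex_angles N₁.tileAngles N₂.tileAngles N₃.tileAngles N₄.tileAngles
      S₁.tileAngles S₂.tileAngles S₃.tileAngles S₄.tileAngles v₀ v₁ v₂ v₃ v₄ v₅ hN hS hα hβ hγ hδ
      (h.alpha_ne_gamma hF0) (h.beta_ne_delta hF0) hα' hβ' hγ' hδ' (h.order hF0 hF)
  · have := W.eight_le
    omega
  -- Closing up turns `v (-2)` and `v (-1)` into `v 6` and `v 7`, where three displayed tiles meet,
  -- and makes the four corners at each pole go full circle.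
  · obtain ⟨e6, e7⟩ := W.closed hF N₄.exists_other_tile
    have v₆ : n₁z + n₄z + s₄y = 2 * π := by
      have c1 := N₁.cornerz
      have c3 := S₄.cornery
      rw [← e6, ← e7] at c1
      exact sum_three (nne 0 3 (by decide)) (nsne 0 3) (nsne 3 3) c1 N₄.cornerz.symm c3
    have v₇ : n₁y + s₁z + s₄z = 2 * π := by
      have c1 := N₁.cornery
      have c2 := S₁.cornerz
      rw [← e6, ← e7] at c1
      rw [← e7] at c2
      exact sum_three (nsne 0 0) (nsne 0 3) (sne 0 3 (by decide)) c1.symm c2 S₄.cornerz.symm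
    exact left_pattern_closed_angles N₁.tileAngles N₂.tileAngles N₃.tileAngles N₄.tileAngles
      S₁.tileAngles S₂.tileAngles S₃.tileAngles S₄.tileAngles v₀ v₁ v₂ v₃ v₄ v₅ v₆ v₇
      (hN' e6) (hS' e7) hα hβ hγ hδ (h.alpha_ne_gamma hF0) (h.beta_ne_delta hF0)
      (h.ne_pi hF0).2.1 (h.ne_pi hF0).2.2.1

theorem not_rightPattern (h : T.Dims a b c α β γ δ)
    (hF : (∀ j, IsSphConvex (T.tile j)) ∨ F = 6 ∨ F = 8) (hp : T.RightPattern b N S v) :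
    False := by
  obtain ⟨⟨f₁, f₂, f₃, f₄⟩, g₁, g₂, g₃, g₄⟩ := hp.wheel.faces
  have e3 := (sdist_comm _ _).trans hp.edge3
  have e4 := (sdist_comm _ _).trans hp.edge4
  obtain ⟨n₁, n₁x, n₁y, n₁z, n₁p, N₁⟩ := f₁.rotate.reverse.labelled h hp.edge1
  obtain ⟨n₂, n₂x, n₂y, n₂z, n₂p, N₂⟩ := f₂.labelled h hp.edge1
  obtain ⟨n₃, n₃x, n₃y, n₃z, n₃p, N₃⟩ := f₃.reverse.labelled h e3
  obtain ⟨n₄, n₄x, n₄y, n₄z, n₄p, N₄⟩ := f₄.reverse.labelled h e4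
  obtain ⟨s₁, s₁x, s₁y, s₁z, s₁p, S₁⟩ := g₁.rotate.reverse.labelled h hp.edge2
  obtain ⟨s₂, s₂x, s₂y, s₂z, s₂p, S₂⟩ := g₂.labelled h hp.edge2
  obtain ⟨s₃, s₃x, s₃y, s₃z, s₃p, S₃⟩ := g₃.reverse.rotate.labelled h e3
  obtain ⟨s₄, s₄x, s₄y, s₄z, s₄p, S₄⟩ := g₄.reverse.rotate.labelled h e4
  have W := wheelTiles_of_ranges hp.wheel
    (N₁.range_eq.trans (insert_rotate_three _ _ _ _)) N₂.range_eq
    (N₃.range_eq.trans (by ext; simp only [mem_insert_iff, mem_singleton_iff]; tauto))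
    (N₄.range_eq.trans (by ext; simp only [mem_insert_iff, mem_singleton_iff]; tauto))
    (S₁.range_eq.trans (insert_rotate_three _ _ _ _)) S₂.range_eq
    (S₃.range_eq.trans (by ext; simp only [mem_insert_iff, mem_singleton_iff]; tauto))
    (S₄.range_eq.trans (by ext; simp only [mem_insert_iff, mem_singleton_iff]; tauto))
  have hinj := W.injective
  have nne : ∀ i j : Fin 4, i ≠ j → ![n₁, n₂, n₃, n₄] i ≠ ![n₁, n₂, n₃, n₄] j :=
    fun i j hij => (hinj.comp Sum.inl_injective).ne hij
  have sne : ∀ i j : Fin 4, i ≠ j → ![s₁, s₂, s₃, s₄] i ≠ ![s₁, s₂, s₃, s₄] j :=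
    fun i j hij => (hinj.comp Sum.inr_injective).ne hij
  have nsne := W.ne
  have hF0 : 0 < F := by have := W.eight_le; omega
  have v₀ : n₁x + n₂x + s₁y = 2 * π :=
    sum_three (nne 0 1 (by decide)) (nsne 0 0) (nsne 1 0) N₁.cornerx.symm N₂.cornerx S₁.cornery
  have v₁ : s₁x + s₂x + n₂y = 2 * π :=
    sum_three (sne 0 1 (by decide)) (nsne 1 0).symm (nsne 1 1).symm S₁.cornerx.symm S₂.cornerx
      N₂.cornery.symm
  have v₂ : n₂z + s₂y + n₃y = 2 * π :=
    sum_three (nsne 1 1) (nne 1 2 (by decide)) (nsne 2 1).symm N₂.cornerz.symm S₂.cornery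
      N₃.cornery
  have v₃ : s₂z + n₃x + s₃x = 2 * π :=
    sum_three (nsne 2 1).symm (sne 1 2 (by decide)) (nsne 2 2) S₂.cornerz.symm N₃.cornerx.symm
      S₃.cornerx
  have v₄ : n₃p + s₃p + n₄y = 2 * π :=
    sum_three (nsne 2 2) (nne 2 3 (by decide)) (nsne 3 2).symm N₃.cornerP S₃.cornerP.symm
      N₄.cornery
  have v₅ : n₄x + s₄x + s₃z = 2 * π :=
    sum_three (nsne 3 3) (nsne 3 2) (sne 3 2 (by decide)) N₄.cornerx.symm S₄.cornerx
      S₃.cornerz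
  obtain ⟨hN, hN'⟩ := sum_four (hinj.comp Sum.inl_injective) N₁.cornerP N₂.cornerP.symm
    N₃.cornerz N₄.cornerz
  obtain ⟨hS, hS'⟩ := sum_four (hinj.comp Sum.inr_injective) S₁.cornerP S₂.cornerP.symm
    S₃.cornery S₄.cornery
  obtain ⟨hα, hβ, hγ, hδ⟩ := h.pos hF0
  by_cases hac : a = c
  swap
  · exact right_pattern_unequal hac N₃ N₄ S₂
  subst hac
  rcases hF with hF | hF | hF
  · obtain ⟨hα', hβ', hγ', hδ'⟩ := h.lt_pi hF0 hF
    exact right_pattern_convex_angles N₁.tileAngles N₂.tileAngles N₃.tileAngles N₄.tileAngles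
      S₁.tileAngles S₂.tileAngles S₃.tileAngles S₄.tileAngles v₀ v₁ v₂ v₃ v₄ v₅ hN hS hα hβ hγ hδ
      (h.alpha_ne_gamma hF0) (h.beta_ne_delta hF0) hα' hβ' hγ' hδ' (h.order hF0 hF)
  · have := W.eight_le
    omega
  -- In `N₄` the base point is now `v 6` and the last vertex is `N`, so the same edge `N (v 6)`
  -- comes with its ends exchanged.
  · obtain ⟨i, hi, hi6, hiN⟩ := N₄.exists_other_tile
    obtain ⟨e6, e7⟩ := W.closed hF ⟨i, hi, hiN, hi6⟩
    have v₆ : n₁z + n₄p + s₄p = 2 * π := by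
      have c1 := N₁.cornerz
      rw [← e6, ← e7] at c1
      exact sum_three (nne 0 3 (by decide)) (nsne 0 3) (nsne 3 3) c1 N₄.cornerP S₄.cornerP.symm
    have v₇ : n₁y + s₁z + s₄z = 2 * π := by
      have c1 := N₁.cornery
      have c2 := S₁.cornerz
      rw [← e6, ← e7] at c1
      rw [← e7] at c2
      exact sum_three (nsne 0 0) (nsne 0 3) (sne 0 3 (by decide)) c1.symm c2 S₄.cornerz
    exact right_pattern_closed_angles N₁.tileAngles N₂.tileAngles N₃.tileAngles N₄.tileAngles
      S₁.tileAngles S₂.tileAngles S₃.tileAngles S₄.tileAngles v₀ v₁ v₂ v₃ v₄ v₅ v₆ v₇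
      (hN' e6) (hS' e7) hα hβ hγ hδ (h.alpha_ne_gamma hF0) (h.beta_ne_delta hF0)
      (h.ne_pi hF0).2.1 (h.ne_pi hF0).2.2.1

theorem IsWheelPart.card_pos (w : T.IsWheelPart N S v) : 0 < F := by
  obtain ⟨j, -⟩ := w.faces.1.1
  exact j.pos

end SphericalTiling

theorem theorem3 (F : ℕ) (T : SphericalTiling F) (hcongr : T.Congruent) (a b : ℝ)
    (htype : (∀ j, IsType2 (T.vert j) a b) ∨ (∃ c : ℝ, ∀ j, IsType4 (T.vert j) a b c))
    (hF : (∀ j, IsSphConvex (T.tile j)) ∨ F = 6 ∨ F = 8) :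
    (¬ ∃ (N S : Sph) (v : ℤ → Sph), T.LeftPattern b N S v) ∧
      (¬ ∃ (N S : Sph) (v : ℤ → Sph), T.RightPattern b N S v) := by
  constructor
  · rintro ⟨N, S, v, hp⟩
    obtain ⟨c, α, β, γ, δ, h⟩ := T.exists_dims hcongr htype hp.wheel.card_pos
    exact SphericalTiling.not_leftPattern h hF hp
  · rintro ⟨N, S, v, hp⟩
    obtain ⟨c, α, β, γ, δ, h⟩ := T.exists_dims hcongr htype hp.wheel.card_pos
    exact SphericalTiling.not_rightPattern h hF hp
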